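/- Notation. $L_{2e}^n$ is the space of (classes modulo null sets of) locally square integrable signals $x:[0,\infty)\to\mathbb R^n$, $L_2^n\subset L_{2e}^n$ consists of those with $\|x\|^2=\int_0^\infty |x(t)|^2dt<\infty$, and $\hat x(i\omega)=\int_0^\infty x(t)e^{-i\omega t}dt$ is the ($L_2$-)Fourier transform of $x\in L_2^n$. For $T>0$, $P_Tx$ equals $x$ on $[0,T]$ and $0$ on $(T,\infty)$. A map $\Delta:L_{2e}^{n_z}\to L_{2e}^{n_w}$ is causal if $P_T\Delta=P_T\Delta P_T$ for all $T>0$, and stable (bounded) if there is $\gamma\ge 0$ with $\|\Delta(z)\|\le\gamma\|z\|$ for all $z\in L_2^{n_z}$. A real matrix is Hurwitz if all its eigenvalues have negative real part. Let $A_\Psi\in\mathbb R^{n_\xi\times n_\xi}$ be Hurwitz, let $\Psi(s)=C_\Psi(sI-A_\Psi)^{-1}B_\Psi+D_\Psi$ be a real $n_y\times(n_z+n_w)$ transfer matrix, let $M=M^T\in\mathbb R^{n_y\times n_y}$, and put $\Pi=\Psi^*M\Psi$ with $\Psi^*(s)=\Psi(-s)^T$, so that $\Pi(\infty)=D_\Psi^TMD_\Psi$.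 A matrix $\tilde Z=\tilde Z^T\in\mathbb R^{n_\xi\times n_\xi}$ is said to certify a canonical factorization of $\Pi$ if there are $\tilde M=\tilde M^T\in\mathbb R^{(n_z+n_w)\times(n_z+n_w)}$, $\tilde C\in\mathbb R^{(n_z+n_w)\times n_\xi}$ and an invertible $\tilde D\in\mathbb R^{(n_z+n_w)\times(n_z+n_w)}$ such that $$\begin{pmatrix}I&0\\A_\Psi&B_\Psi\\C_\Psi&D_\Psi\end{pmatrix}^T\begin{pmatrix}0&\tilde Z&0\\\tilde Z&0&0\\0&0&M\end{pmatrix}\begin{pmatrix}I&0\\A_\Psi&B_\Psi\\C_\Psi&D_\Psi\end{pmatrix}=\begin{pmatrix}\tilde C&\tilde D\end{pmatrix}^T\tilde M\begin{pmatrix}\tilde C&\tilde D\end{pmatrix}$$ and $A_\Psi-B_\Psi\tilde D^{-1}\tilde C$ is Hurwitz. (Then $\Pi=\tilde\Psi^*\tilde M\tilde\Psi$ for $\tilde\Psi(s)=\tilde C(sI-A_\Psi)^{-1}B_\Psi+\tilde D$, and both $\tilde\Psi$ and $\tilde\Psi^{-1}$ are stable.) Lemma. Let $\Delta:L_{2e}^{n_z}\to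 L_{2e}^{n_w}$ be causal and stable and suppose that $$\int_{-\infty}^\infty\begin{pmatrix}\hat z(i\omega)\\\widehat{\Delta(z)}(i\omega)\end{pmatrix}^*\Pi(i\omega)\begin{pmatrix}\hat z(i\omega)\\\widehat{\Delta(z)}(i\omega)\end{pmatrix}d\omega\ge 0\quad\text{for all }z\in L_2^{n_z}.$$ Suppose moreover that the right-lower $n_w\times n_w$ block of $\Pi$ is negative semidefinite on $i\mathbb R\cup\{\infty\}$ and that $\tilde Z$ certifies a canonical factorization of $\Pi=\Psi^*M\Psi$. Then $\Delta$ satisfies a finite-horizon IQC with terminal cost matrix $\tilde Z$; that is, for every $z\in L_{2e}^{n_z}$ the solution of $$\dot\xi=A_\Psi\xi+B_\Psi u,\quad \xi(0)=0,\quad y=C_\Psi\xi+D_\Psi u,\quad u=\begin{pmatrix}z\\\Delta(z)\end{pmatrix}$$ satisfies $$\int_0^Ty(t)^TMy(t)\,dt+\xi(T)^T\tilde Z\xi(T)\ge 0\quad\text{for all }T>0.$$ -/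

import Mathlib

open MeasureTheory Matrix
open scoped ENNReal NNReal FourierTransform ComplexOrder

noncomputable section

namespace IQC

/-! ### Signal spaces on the half line -/

/-- Lebesgue measure on the time axis `[0, ∞)`. -/
abbrev halfLine : Measure ℝ := volume.restrict (Set.Ici 0)

/-- `L₂ₑ`: (classes modulo null sets of) measurable signals on `[0, ∞)` with values in Euclidean
space that are square integrable on every interval `[0, T]`. -/
def L2e (ι : Type*) [Fintype ι] : Type _ :=
  {x : ℝ →ₘ[halfLine] EuclideanSpace ℝ ι // ∀ T : ℝ, MemLp x 2 (volume.restrict (Set.Icc 0 T))}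

instance (ι : Type*) [Fintype ι] : CoeFun (L2e ι) (fun _ => ℝ → EuclideanSpace ℝ ι) :=
  ⟨fun x => x.1⟩

/-- The signal has finite energy, that is, it belongs to `L₂`. -/
def IsL2 {ι : Type*} [Fintype ι] (x : L2e ι) : Prop := MemLp x 2 halfLine

/-- The norm `‖x‖ = (∫₀^∞ |x(t)|² dt)^(1/2)`, with value `∞` for signals outside `L₂`. -/
def energyNorm {ι : Type*} [Fintype ι] (x : L2e ι) : ℝ≥0∞ := eLpNorm x 2 halfLine

lemma aestronglyMeasurable_indicator {ι : Type*} [Fintype ι] (T : ℝ) (x : L2e ι) :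
    AEStronglyMeasurable ((Set.Iic T).indicator x) halfLine :=
  x.1.aestronglyMeasurable.indicator measurableSet_Iic

/-- The truncation `P_T x`: it equals `x` on `[0, T]` and `0` on `(T, ∞)`. -/
def truncate {ι : Type*} [Fintype ι] (T : ℝ) (x : L2e ι) : L2e ι :=
  ⟨AEEqFun.mk ((Set.Iic T).indicator x) (aestronglyMeasurable_indicator T x), fun S => by
    have h1 : AEEqFun.mk ((Set.Iic T).indicator x) (aestronglyMeasurable_indicator T x)
        =ᵐ[volume.restrict (Set.Icc 0 S)] (Set.Iic T).indicator x :=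
      ae_mono (Measure.restrict_mono (fun _ h => h.1) le_rfl) (AEEqFun.coeFn_mk _ _)
    exact ((x.2 S).indicator measurableSet_Iic).ae_eq h1.symm⟩

/-- A system is causal if its output up to time `T` depends only on its input up to time `T`:
`P_T S = P_T S P_T` for all `T > 0`. -/
def IsCausal {ι κ : Type*} [Fintype ι] [Fintype κ] (S : L2e ι → L2e κ) : Prop :=
  ∀ T : ℝ, 0 < T → ∀ x : L2e ι, truncate T (S x) = truncate T (S (truncate T x))

/-- A system is bounded (stable) if its induced `L₂`-gain is finite. -/
def IsBounded {ι κ : Type*} [Fintype ι] [Fintype κ] (S : L2e ι → L2e κ) : Prop :=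
  ∃ γ : ℝ≥0, ∀ x : L2e ι, IsL2 x → energyNorm (S x) ≤ γ * energyNorm x

lemma IsBounded.isL2 {ι κ : Type*} [Fintype ι] [Fintype κ] {S : L2e ι → L2e κ}
    (hS : IsBounded S) {x : L2e ι} (hx : IsL2 x) : IsL2 (S x) := by
  obtain ⟨γ, h⟩ := hS
  have hm : AEStronglyMeasurable (S x) halfLine := (S x).1.aestronglyMeasurable
  exact ⟨hm, (h x hx).trans_lt (ENNReal.mul_lt_top ENNReal.coe_lt_top hx.2)⟩

/-! ### The Fourier transform of finite energy signals -/

/-- The extension of a signal by zero to negative times, with complex values. -/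
def extendZero {ι : Type*} [Fintype ι] (x : L2e ι) : ℝ → EuclideanSpace ℂ ι :=
  (Set.Ici (0 : ℝ)).indicator fun t => WithLp.toLp 2 fun i => ((x t i : ℝ) : ℂ)

lemma memLp_extendZero {ι : Type*} [Fintype ι] {x : L2e ι} (hx : IsL2 x) :
    MemLp (extendZero x) 2 (volume : Measure ℝ) := by
  unfold extendZero
  rw [memLp_indicator_iff_restrict measurableSet_Ici]
  have hc : Continuous fun v : EuclideanSpace ℝ ι =>
      (WithLp.toLp 2 fun i => ((v i : ℝ) : ℂ) : EuclideanSpace ℂ ι) := by fun_prop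
  have hm : AEStronglyMeasurable (x : ℝ → EuclideanSpace ℝ ι) halfLine :=
    x.1.aestronglyMeasurable
  refine MemLp.of_le hx (hc.comp_aestronglyMeasurable hm) (Filter.Eventually.of_forall fun t => ?_)
  simp [EuclideanSpace.norm_eq]

/-- The Fourier transform `x̂(iω) = ∫₀^∞ x(t) exp(-iωt) dt` of a signal in `L₂`, as a function of
the frequency `ω` (defined up to null sets). Mathlib's transform uses the kernel
`exp(-2πiωt)`, whence the rescaling. -/
def fourierL2 {ι : Type*} [Fintype ι] (x : L2e ι) (hx : IsL2 x) (ω : ℝ) : EuclideanSpace ℂ ι :=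
  (𝓕 ((memLp_extendZero hx).toLp (extendZero x)) : Lp (EuclideanSpace ℂ ι) 2 (volume : Measure ℝ))
    (ω / (2 * Real.pi))

/-! ### Linear systems in state space form -/

/-- A square real matrix is Hurwitz if all its complex eigenvalues have negative real part. -/
def IsHurwitz {n : Type*} [Fintype n] [DecidableEq n] (A : Matrix n n ℝ) : Prop :=
  ∀ μ ∈ spectrum ℂ (A.map (algebraMap ℝ ℂ)), μ.re < 0

/-- A system `ẋ = A x + B u`, `y = C x + D u` with state index `n`, input index `m`,
output index `p`. -/
structure StateSpace (n m p : Type*) where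
  A : Matrix n n ℝ
  B : Matrix n m ℝ
  C : Matrix p n ℝ
  D : Matrix p m ℝ

namespace StateSpace

variable {n m p : Type*} [Fintype n] [DecidableEq n] [Fintype m] [Fintype p]

/-- The transfer matrix `C (sI - A)⁻¹ B + D`. -/
def transfer (Ψ : StateSpace n m p) (s : ℂ) : Matrix p m ℂ :=
  Ψ.C.map (algebraMap ℝ ℂ) * (s • (1 : Matrix n n ℂ) - Ψ.A.map (algebraMap ℝ ℂ))⁻¹
    * Ψ.B.map (algebraMap ℝ ℂ) + Ψ.D.map (algebraMap ℝ ℂ)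

/-- The multiplier `Π(s) = Ψ*(s) M Ψ(s)` with `Ψ*(s) = Ψ(-s)ᵀ`. -/
def multiplier (Ψ : StateSpace n m p) (M : Matrix p p ℝ) (s : ℂ) : Matrix m m ℂ :=
  (Ψ.transfer (-s))ᵀ * M.map (algebraMap ℝ ℂ) * Ψ.transfer s

/-- The value `Π(∞) = Dᵀ M D` of the multiplier at infinity. -/
def multiplierInfty (Ψ : StateSpace n m p) (M : Matrix p p ℝ) : Matrix m m ℂ :=
  (Ψ.Dᵀ * M * Ψ.D).map (algebraMap ℝ ℂ)

/-- `ξ` is the (Carathéodory) solution on `[0, ∞)` of `ξ̇ = A ξ + B u`, `ξ(0) = 0`. -/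
def IsTrajectory (Ψ : StateSpace n m p) (u : ℝ → m → ℝ) (ξ : ℝ → n → ℝ) : Prop :=
  ContinuousOn ξ (Set.Ici 0) ∧
    ∀ t : ℝ, 0 ≤ t → ξ t = ∫ s in (0 : ℝ)..t, (Ψ.A *ᵥ ξ s + Ψ.B *ᵥ u s)

/-- The output `y = C ξ + D u`. -/
def output (Ψ : StateSpace n m p) (u : ℝ → m → ℝ) (ξ : ℝ → n → ℝ) (t : ℝ) : p → ℝ :=
  Ψ.C *ᵥ ξ t + Ψ.D *ᵥ u t

/-- The stacked matrix `[I 0; A B; C D]`. -/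
def outerFactor (Ψ : StateSpace n m p) : Matrix (n ⊕ (n ⊕ p)) (n ⊕ m) ℝ :=
  fromRows (fromCols (1 : Matrix n n ℝ) (0 : Matrix n m ℝ))
    (fromRows (fromCols Ψ.A Ψ.B) (fromCols Ψ.C Ψ.D))

/-- The matrix `[I 0; A B; C D]ᵀ [0 X 0; X 0 0; 0 0 M] [I 0; A B; C D]`. -/
def kyp (Ψ : StateSpace n m p) (X : Matrix n n ℝ) (M : Matrix p p ℝ) :
    Matrix (n ⊕ m) (n ⊕ m) ℝ :=
  Ψ.outerFactorᵀ *
    fromBlocks (0 : Matrix n n ℝ) (fromCols X (0 : Matrix n p ℝ))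
      (fromRows X (0 : Matrix p n ℝ)) (fromBlocks (0 : Matrix n n ℝ) 0 0 M) *
    Ψ.outerFactor

/-- `Z` certifies a canonical factorization `Ψ* M Ψ = Ψ'* M' Ψ'`, where `M'` is real symmetric,
`Ψ' = (A, B, C', D')` has the state matrix and the input matrix of `Ψ`, and `Ψ'` and its inverse
are stable: for some `M'`, `C'`, `D'` with `D'` invertible,
`[I 0; A B; C D]ᵀ [0 Z 0; Z 0 0; 0 0 M] [I 0; A B; C D] = [C' D']ᵀ M' [C' D']`
and `A - B D'⁻¹ C'` is Hurwitz. -/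
def Certifies [DecidableEq m] (Ψ : StateSpace n m p) (M : Matrix p p ℝ) (Z : Matrix n n ℝ) :
    Prop :=
  Z.IsSymm ∧ ∃ (M' : Matrix m m ℝ) (C' : Matrix m n ℝ) (D' : Matrix m m ℝ),
    M'.IsSymm ∧ IsUnit D'.det ∧
    Ψ.kyp Z M =
      (fromCols C' D')ᵀ * M' * fromCols C' D' ∧
    IsHurwitz (Ψ.A - Ψ.B * D'⁻¹ * C')

end StateSpace

/-! ### Integral quadratic constraints -/

/-- The right-lower block of `Π = Ψ* M Ψ` is negative semidefinite on the extended imaginary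
axis. -/
def NegSemidefLowerRight {n p ζ ω : Type*} [Fintype n] [DecidableEq n] [Fintype p] [Fintype ζ]
    [Fintype ω] (Ψ : StateSpace n (ζ ⊕ ω) p) (M : Matrix p p ℝ) : Prop :=
  (∀ w : ℝ, (-(Ψ.multiplier M (Complex.I * w)).toBlocks₂₂).PosSemidef) ∧
    (-(Ψ.multiplierInfty M).toBlocks₂₂).PosSemidef

/-- The bounded system `Δ` satisfies the frequency domain integral quadratic constraint
`∫ col(ẑ, Δ(z)^)* Π col(ẑ, Δ(z)^) dω ≥ 0` for all `z ∈ L₂`, where `Π = Ψ* M Ψ`. -/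
def SatisfiesIQC {n p ζ ω : Type*} [Fintype n] [DecidableEq n] [Fintype p] [Fintype ζ]
    [Fintype ω] (Ψ : StateSpace n (ζ ⊕ ω) p) (M : Matrix p p ℝ) (Δ : L2e ζ → L2e ω)
    (hΔ : IsBounded Δ) : Prop :=
  ∀ (z : L2e ζ) (hz : IsL2 z),
    0 ≤ ∫ w : ℝ,
      (star (Sum.elim (fourierL2 z hz w) (fourierL2 (Δ z) (hΔ.isL2 hz) w)) ⬝ᵥ
        (Ψ.multiplier M (Complex.I * w) *ᵥ
          Sum.elim (fourierL2 z hz w) (fourierL2 (Δ z) (hΔ.isL2 hz) w))).re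

/-- The stacked signal `col(z, w)`. -/
def col {ζ ω : Type*} [Fintype ζ] [Fintype ω] (z : L2e ζ) (w : L2e ω) (t : ℝ) : ζ ⊕ ω → ℝ :=
  Sum.elim (z t) (w t)

/-- `Δ` satisfies a finite-horizon IQC with terminal cost matrix `Z = Zᵀ`: along all trajectories
of the filter `Ψ` driven by `col(z, Δ(z))` with `z ∈ L₂ₑ`, and for all `T > 0`,
`∫₀ᵀ y(t)ᵀ M y(t) dt + ξ(T)ᵀ Z ξ(T) ≥ 0`. -/
def FiniteHorizonIQC {n p ζ ω : Type*} [Fintype n] [DecidableEq n] [Fintype p] [Fintype ζ]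
    [Fintype ω] (Ψ : StateSpace n (ζ ⊕ ω) p) (M : Matrix p p ℝ) (Z : Matrix n n ℝ)
    (Δ : L2e ζ → L2e ω) : Prop :=
  Z.IsSymm ∧ ∀ (z : L2e ζ) (ξ : ℝ → n → ℝ), Ψ.IsTrajectory (col z (Δ z)) ξ →
    ∀ T : ℝ, 0 < T →
      0 ≤ (∫ t in (0 : ℝ)..T,
            Ψ.output (col z (Δ z)) ξ t ⬝ᵥ (M *ᵥ Ψ.output (col z (Δ z)) ξ t)) +
          ξ T ⬝ᵥ (Z *ᵥ ξ T)

end IQC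

end

/-! The proof continues the given signal beyond `T` in the way that is best for the argument, and
then applies the infinite-horizon constraint to the result.

Let `x = ξ(T)`. By `exists_openLoop_input` there is an `L₂` signal `zc`, chosen from `x` alone, such
that against every `L₂` signal `w` the filter started at `x` with input `col(zc, w)` has supply `∫
yᵀMy ≤ xᵀZx`. Play `z` up to `T` and `zc` afterwards. This concatenation is in `L₂`, so its image
under `Δ` is in `L₂` too, and by causality that image agrees with `Δ(z)` on `[0, T]`. Its tail is
unknown but is an admissible `w`. The total supply is nonnegative by the IQC
(`SatisfiesIQC.integral_output_nonneg`), the tail contributes at most `xᵀZx`, and the claim follows.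
Fixing `zc` before the tail of the output is known is what avoids an algebraic loop.

To find `zc`, take the input `us = -D'⁻¹C'ξs` and its state `ξs`, for which the factor's output
`C'ξs + D'us` vanishes; it decays because `A - BD'⁻¹C'` is Hurwitz. The signal `zc` is the first
block of `us`. Any other `w` adds a filter response `η` from the zero state to an input `col(0, h)`.
The supply then splits into three parts. The supply along `ξs` is `xᵀZx`; the cross terms vanish,
both by the polarized storage identity `StateSpace.isPrimitive_storage`; and the supply along `η` is
nonpositive by the sign of the lower right block.

Time and frequency domain are linked by the Parseval identity `StateSpace.integral_output_eq`. The
necessary `L₂` bounds on states come from a Lyapunov argument, `IsSolution.squareIntegrable`. -/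

namespace IQC

/-! ### Primitives on the half line -/

/-- On `[0, ∞)` the function `f` is a primitive of the locally integrable function `f'`. -/
structure IsPrimitive (f f' : ℝ → ℝ) : Prop where
  intervalIntegrable : ∀ T : ℝ, 0 ≤ T → IntervalIntegrable f' volume 0 T
  eq_integral : ∀ T : ℝ, 0 ≤ T → f T = f 0 + ∫ t in (0 : ℝ)..T, f' t

namespace IsPrimitive

variable {f f' g g' : ℝ → ℝ}

lemma congr_deriv (hf : IsPrimitive f f') (h : ∀ t, 0 ≤ t → f' t = g' t) :
    IsPrimitive f g' := by
  have h' : ∀ T : ℝ, 0 ≤ T → Set.EqOn f' g' (Set.uIcc 0 T) := fun T hT t ht => by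
    rw [Set.uIcc_of_le hT] at ht
    exact h t ht.1
  refine ⟨fun T hT => (hf.intervalIntegrable T hT).congr
    (fun t ht => h' T hT (Set.uIoc_subset_uIcc ht)), fun T hT => ?_⟩
  rw [hf.eq_integral T hT, intervalIntegral.integral_congr (h' T hT)]

/-- Formulated for the explicit integral because `f` is arbitrary at negative times, which would
spoil two-sided derivatives at `0`. -/
lemma absolutelyContinuousOnInterval (hf : IsPrimitive f f') {T : ℝ} (hT : 0 ≤ T) :
    AbsolutelyContinuousOnInterval (fun t => f 0 + ∫ s in (0 : ℝ)..t, f' s) 0 T := by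
  have h1 := (hf.intervalIntegrable T hT).absolutelyContinuousOnInterval_intervalIntegral
    (c := 0) (by simp)
  have h2 : AbsolutelyContinuousOnInterval (fun _ : ℝ => f 0) 0 T :=
    ((LipschitzWith.const (f 0)).lipschitzOnWith (s := Set.uIcc 0 T)).absolutelyContinuousOnInterval
  exact h2.add h1

lemma continuousOn (hf : IsPrimitive f f') : ContinuousOn f (Set.Ici 0) := by
  intro t ht
  have h0 : (0 : ℝ) ≤ t + 1 := by linarith [Set.mem_Ici.1 ht]
  have h1 := (hf.absolutelyContinuousOnInterval h0).continuousOn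
  rw [Set.uIcc_of_le h0] at h1
  have h2 : ContinuousOn f (Set.Icc 0 (t + 1)) := h1.congr fun s hs => hf.eq_integral s hs.1
  refine (h2 t ⟨ht, by linarith⟩).mono_of_mem_nhdsWithin ?_
  rw [← Set.Ici_inter_Iic]
  exact inter_mem_nhdsWithin _ (Iic_mem_nhds (by linarith))

lemma intervalIntegrable_self (hf : IsPrimitive f f') {T : ℝ} (hT : 0 ≤ T) :
    IntervalIntegrable f volume 0 T := by
  refine ContinuousOn.intervalIntegrable (hf.continuousOn.mono ?_)
  rw [Set.uIcc_of_le hT]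
  exact fun t ht => ht.1

lemma add (hf : IsPrimitive f f') (hg : IsPrimitive g g') :
    IsPrimitive (fun t => f t + g t) (fun t => f' t + g' t) := by
  refine ⟨fun T hT => (hf.intervalIntegrable T hT).add (hg.intervalIntegrable T hT),
    fun T hT => ?_⟩
  rw [intervalIntegral.integral_add (hf.intervalIntegrable T hT) (hg.intervalIntegrable T hT),
    hf.eq_integral T hT, hg.eq_integral T hT]
  ring

lemma const_mul (c : ℝ) (hf : IsPrimitive f f') :
    IsPrimitive (fun t => c * f t) (fun t => c * f' t) := by
  refine ⟨fun T hT => (hf.intervalIntegrable T hT).const_mul c, fun T hT => ?_⟩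
  rw [intervalIntegral.integral_const_mul, hf.eq_integral T hT]
  ring

lemma const (c : ℝ) : IsPrimitive (fun _ => c) (fun _ => 0) :=
  ⟨fun _ _ => intervalIntegrable_const, fun _ _ => by simp⟩

lemma sum {ι : Type*} (s : Finset ι) {f f' : ι → ℝ → ℝ} (h : ∀ i, IsPrimitive (f i) (f' i)) :
    IsPrimitive (fun t => ∑ i ∈ s, f i t) (fun t => ∑ i ∈ s, f' i t) := by
  classical
  induction s using Finset.induction_on with
  | empty => simpa using const 0
  | insert a s ha ih =>
    simp only [Finset.sum_insert ha]
    exact (h a).add ih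

/-- Integration by parts for absolutely continuous functions; Lebesgue differentiation identifies
the derivatives almost everywhere. -/
lemma mul (hf : IsPrimitive f f') (hg : IsPrimitive g g') :
    IsPrimitive (fun t => f t * g t) (fun t => f' t * g t + f t * g' t) := by
  have hsub : ∀ {T : ℝ}, 0 ≤ T → Set.uIcc 0 T ⊆ Set.Ici 0 := fun {T} hT => by
    rw [Set.uIcc_of_le hT]
    exact fun t ht => ht.1
  refine ⟨fun T hT => ((hf.intervalIntegrable T hT).mul_continuousOn
    (hg.continuousOn.mono (hsub hT))).add ((hg.intervalIntegrable T hT).continuousOn_mul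
    (hf.continuousOn.mono (hsub hT))), fun T hT => ?_⟩
  have key := (hf.absolutelyContinuousOnInterval hT).integral_deriv_mul_eq_sub
    (hg.absolutelyContinuousOnInterval hT)
  simp only [intervalIntegral.integral_same, add_zero] at key
  rw [← hf.eq_integral T hT, ← hg.eq_integral T hT] at key
  rw [← sub_eq_iff_eq_add', ← key]
  refine intervalIntegral.integral_congr_ae ?_
  filter_upwards [(hf.intervalIntegrable T hT).ae_hasDerivAt_integral,
    (hg.intervalIntegrable T hT).ae_hasDerivAt_integral] with t h1 h2 ht
  have ht' : t ∈ Set.uIcc 0 T := Set.uIoc_subset_uIcc ht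
  have h0 : 0 ≤ t := hsub hT ht'
  have e1 := ((h1 ht' 0 (by simp)).const_add (f 0)).deriv
  have e2 := ((h2 ht' 0 (by simp)).const_add (g 0)).deriv
  rw [e1, e2, ← hf.eq_integral t h0, ← hg.eq_integral t h0]

lemma of_hasDerivAt (h : ∀ t, HasDerivAt f (f' t) t) (hc : Continuous f') : IsPrimitive f f' := by
  refine ⟨fun T _ => hc.intervalIntegrable _ _, fun T _ => ?_⟩
  rw [intervalIntegral.integral_eq_sub_of_hasDerivAt (fun t _ => h t) (hc.intervalIntegrable _ _)]
  ring

lemma tendsto_atTop (hf : IsPrimitive f f') (h : IntegrableOn f' (Set.Ioi 0)) :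
    Filter.Tendsto f Filter.atTop (nhds (f 0 + ∫ t in Set.Ioi 0, f' t)) := by
  refine ((intervalIntegral_tendsto_integral_Ioi 0 h Filter.tendsto_id).const_add (f 0)).congr' ?_
  filter_upwards [Filter.eventually_ge_atTop 0] with T hT
  exact (hf.eq_integral T hT).symm

/-- Integrability of `f'` yields a limit of `f` at infinity, and integrability of `f` forces it to
be zero: otherwise a positive constant would be integrable on a ray. -/
lemma integral_deriv_eq_neg (hf : IsPrimitive f f') (hi : IntegrableOn f (Set.Ioi 0))
    (hi' : IntegrableOn f' (Set.Ioi 0)) : ∫ t in Set.Ioi 0, f' t = -f 0 := by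
  have h := hf.tendsto_atTop hi'
  set l := f 0 + ∫ t in Set.Ioi 0, f' t with hl
  suffices h0 : l = 0 by linarith
  by_contra h0
  have hpos : 0 < |l| := abs_pos.2 h0
  obtain ⟨a, ha⟩ := Filter.eventually_atTop.1
    (h.abs.eventually (le_mem_nhds (half_lt_self hpos)))
  have hc : IntegrableOn (fun _ : ℝ => |l| / 2) (Set.Ioi (max a 0)) := by
    refine Integrable.mono' (g := fun t => |f t|) ?_ aestronglyMeasurable_const ?_
    · exact (hi.mono_set (Set.Ioi_subset_Ioi (le_max_right a 0))).abs
    · filter_upwards [ae_restrict_mem measurableSet_Ioi] with t ht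
      rw [Real.norm_of_nonneg (by positivity)]
      exact ha t ((le_max_left a 0).trans (le_of_lt ht))
  rw [integrableOn_const_iff] at hc
  rcases hc with hc | hc
  · simp [h0] at hc
  · simp at hc

end IsPrimitive

/-! ### Solutions with arbitrary initial values -/

/-- `ξ` solves `ξ̇ = A ξ + B u` on `[0, ∞)`, with no condition on `ξ(0)`. -/
def IsSolution {n m : Type*} [Fintype n] [Fintype m] (A : Matrix n n ℝ) (B : Matrix n m ℝ)
    (u : ℝ → m → ℝ) (ξ : ℝ → n → ℝ) : Prop :=
  ∀ i, IsPrimitive (fun t => ξ t i) (fun t => (A *ᵥ ξ t + B *ᵥ u t) i)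

namespace IsSolution

variable {n m : Type*} [Fintype n] [Fintype m] {A : Matrix n n ℝ} {B : Matrix n m ℝ}
  {u v : ℝ → m → ℝ} {ξ η : ℝ → n → ℝ}

/-- Two different solutions are allowed because the cross terms of the supply need the polarized
form. -/
lemma bilinear (hξ : IsSolution A B u ξ) (hη : IsSolution A B v η) (Z : Matrix n n ℝ) :
    IsPrimitive (fun t => ξ t ⬝ᵥ (Z *ᵥ η t))
      (fun t => (A *ᵥ ξ t + B *ᵥ u t) ⬝ᵥ (Z *ᵥ η t)
        + ξ t ⬝ᵥ (Z *ᵥ (A *ᵥ η t + B *ᵥ v t))) := by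
  have h := IsPrimitive.sum Finset.univ fun i => (hξ i).mul
    (IsPrimitive.sum Finset.univ fun j => (hη j).const_mul (Z i j))
  refine h.congr_deriv fun t _ => ?_
  rw [dotProduct, dotProduct, ← Finset.sum_add_distrib]
  rfl

lemma add (hξ : IsSolution A B u ξ) (hη : IsSolution A B v η) :
    IsSolution A B (fun t => u t + v t) (fun t => ξ t + η t) := fun i => by
  refine ((hξ i).add (hη i)).congr_deriv fun t _ => ?_
  simp only [mulVec_add, Pi.add_apply]
  ring

end IsSolution

lemma StateSpace.IsTrajectory.isSolution {n m p : Type*} [Fintype n] [Fintype m]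
    [DecidableEq n] [Fintype p] {Ψ : StateSpace n m p} {u : ℝ → m → ℝ} {ξ : ℝ → n → ℝ}
    (h : Ψ.IsTrajectory u ξ)
    (hu : ∀ T : ℝ, 0 ≤ T → ∀ j, IntervalIntegrable (fun t => u t j) volume 0 T) :
    IsSolution Ψ.A Ψ.B u ξ := by
  have h0 : ξ 0 = 0 := by simpa using h.2 0 le_rfl
  have hsub : ∀ {T : ℝ}, 0 ≤ T → Set.uIcc 0 T ⊆ Set.Ici 0 := fun {T} hT => by
    rw [Set.uIcc_of_le hT]
    exact fun t ht => ht.1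
  have hc := continuousOn_pi.1 h.1
  have hi : ∀ T : ℝ, 0 ≤ T → ∀ i,
      IntervalIntegrable (fun t => (Ψ.A *ᵥ ξ t + Ψ.B *ᵥ u t) i) volume 0 T := fun T hT i => by
    simp only [Pi.add_apply, mulVec, dotProduct]
    refine IntervalIntegrable.add ?_ ?_
    · refine ContinuousOn.intervalIntegrable (continuousOn_finsetSum _ fun j _ => ?_)
      exact continuousOn_const.mul ((hc j).mono (hsub hT))
    · have := IntervalIntegrable.sum (μ := volume) (a := 0) (b := T) Finset.univ
        (f := fun j t => Ψ.B i j * u t j) fun j _ => (hu T hT j).const_mul _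
      have e : (fun t => ∑ j, Ψ.B i j * u t j) = ∑ j, fun t => Ψ.B i j * u t j := by
        ext t
        simp
      rwa [e]
  intro i
  refine ⟨fun T hT => hi T hT i, fun T hT => ?_⟩
  have hi' : IntervalIntegrable (fun s => Ψ.A *ᵥ ξ s + Ψ.B *ᵥ u s) volume 0 T := by
    rw [intervalIntegrable_iff, IntegrableOn]
    exact Integrable.of_eval fun i => intervalIntegrable_iff.1 (hi T hT i)
  have h1 := (ContinuousLinearMap.proj (R := ℝ) (φ := fun _ : n => ℝ) i).intervalIntegral_comp_comm
    hi'
  simp only [ContinuousLinearMap.proj_apply] at h1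
  rw [h1, h0, ← h.2 T hT]
  simp

/-! ### The matrix exponential of a Hurwitz matrix -/

section Exponential

attribute [local instance] Matrix.linftyOpNormedRing Matrix.linftyOpNormedAlgebra
  Matrix.linftyOpNormedAddCommGroup Matrix.linftyOpNormedSpace

variable {n : Type*} [Fintype n] [DecidableEq n]

lemma hasDerivAt_exp_smul_mulVec (A : Matrix n n ℝ) (x : n → ℝ) (t : ℝ) :
    HasDerivAt (fun s : ℝ => NormedSpace.exp (s • A) *ᵥ x)
      (A *ᵥ (NormedSpace.exp (t • A) *ᵥ x)) t := by
  have h := hasDerivAt_exp_smul_const' (𝕂 := ℝ) A t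
  let L : Matrix n n ℝ →L[ℝ] (n → ℝ) :=
    LinearMap.toContinuousLinearMap ((mulVecBilin ℝ ℝ).flip x)
  have h2 := L.hasFDerivAt.comp_hasDerivAt t h
  rw [mulVec_mulVec]
  exact h2

lemma hasDerivAt_exp_smul_apply (A : Matrix n n ℝ) (i j : n) (t : ℝ) :
    HasDerivAt (fun s : ℝ => NormedSpace.exp (s • A) i j)
      ((A * NormedSpace.exp (t • A)) i j) t := by
  have h := hasDerivAt_exp_smul_const' (𝕂 := ℝ) A t
  let L : Matrix n n ℝ →L[ℝ] ℝ := LinearMap.toContinuousLinearMap (entryLinearMap ℝ ℝ i j)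
  exact L.hasFDerivAt.comp_hasDerivAt t h

lemma continuous_exp_smul_apply (A : Matrix n n ℝ) (i j : n) :
    Continuous fun s : ℝ => NormedSpace.exp (s • A) i j :=
  continuous_iff_continuousAt.2 fun t => (hasDerivAt_exp_smul_apply A i j t).continuousAt

/-- All terms of the exponential series from index `k` on annihilate `x`. -/
lemma exp_smul_mulVec_of_pow_mulVec_eq_zero (N : Matrix n n ℂ) (x : n → ℂ) {k : ℕ}
    (h : N ^ k *ᵥ x = 0) (t : ℂ) :
    NormedSpace.exp (t • N) *ᵥ x
      = ∑ j ∈ Finset.range k, ((j.factorial : ℂ)⁻¹ * t ^ j) • (N ^ j *ᵥ x) := by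
  have h1 := NormedSpace.exp_series_hasSum_exp' (𝕂 := ℂ) (t • N)
  let L : Matrix n n ℂ →L[ℂ] (n → ℂ) :=
    LinearMap.toContinuousLinearMap ((mulVecBilin ℂ ℂ).flip x)
  have h2 := L.hasSum h1
  have h3 : ∀ j, L ((j.factorial : ℂ)⁻¹ • (t • N) ^ j)
      = ((j.factorial : ℂ)⁻¹ * t ^ j) • (N ^ j *ᵥ x) := fun j => by
    simp [L, smul_pow, smul_smul]
  simp only [h3] at h2
  refine h2.unique (hasSum_sum_of_ne_finset_zero fun j hj => ?_)
  have hj' : k ≤ j := by simpa using hj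
  have h4 : N ^ j *ᵥ x = 0 := by
    rw [← Nat.sub_add_cancel hj', pow_add, ← mulVec_mulVec, h, mulVec_zero]
  rw [h4, smul_zero]

lemma tendsto_pow_mul_exp_mul_atTop (μ : ℂ) (hμ : μ.re < 0) (j : ℕ) :
    Filter.Tendsto (fun t : ℝ => Complex.exp (t * μ) * (t : ℂ) ^ j) Filter.atTop (nhds 0) := by
  rw [tendsto_zero_iff_norm_tendsto_zero]
  refine (tendsto_rpow_mul_exp_neg_mul_atTop_nhds_zero j (-μ.re) (by linarith)).congr' ?_
  filter_upwards [Filter.eventually_ge_atTop 0] with t ht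
  rw [norm_mul, Complex.norm_exp, norm_pow, Complex.norm_real, Real.norm_of_nonneg ht,
    Real.rpow_natCast, mul_comm]
  congr 2
  simp [mul_comm]

/-- On a generalized eigenvector for `μ` the flow is `exp(tμ)` times a polynomial in `t`, and
generalized eigenvectors span the space. -/
lemma tendsto_exp_smul_mulVec (A : Matrix n n ℂ) (hA : ∀ μ ∈ spectrum ℂ A, μ.re < 0)
    (x : n → ℂ) :
    Filter.Tendsto (fun t : ℝ => NormedSpace.exp ((t : ℂ) • A) *ᵥ x) Filter.atTop (nhds 0) := by
  -- The vectors with decaying orbit form a subspace, so it suffices that it contains every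
  -- generalized eigenspace.
  let S : Submodule ℂ (n → ℂ) :=
    { carrier := {x | Filter.Tendsto (fun t : ℝ => NormedSpace.exp ((t : ℂ) • A) *ᵥ x)
        Filter.atTop (nhds 0)}
      add_mem' := fun {x y} hx hy => by
        simpa [mulVec_add] using Filter.Tendsto.add hx hy
      zero_mem' := by simp
      smul_mem' := fun c x hx => by
        simpa [mulVec_smul] using Filter.Tendsto.const_smul hx c }
  suffices h : S = ⊤ by
    have : x ∈ S := h ▸ Submodule.mem_top
    exact this
  rw [eq_top_iff, ← Module.End.iSup_maxGenEigenspace_eq_top (toLin' A)]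
  refine iSup_le fun μ x hx => ?_
  by_cases hx0 : x = 0
  · rw [hx0]
    exact S.zero_mem
  obtain ⟨k, hk⟩ := (Module.End.mem_maxGenEigenspace _ _ _).1 hx
  have hμ : μ.re < 0 := by
    refine hA μ ?_
    rw [← Matrix.spectrum_toLin']
    refine Module.End.HasEigenvalue.mem_spectrum ?_
    refine Module.End.hasEigenvalue_of_hasGenEigenvalue (k := k) ?_
    exact (Submodule.ne_bot_iff _).2 ⟨x, (Module.End.mem_genEigenspace_nat).2 hk, hx0⟩
  have hk' : (A - μ • (1 : Matrix n n ℂ)) ^ k *ᵥ x = 0 := by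
    rw [← toLin'_apply, toLin'_pow]
    simpa [← Module.End.one_eq_id] using hk
  have e : ∀ t : ℝ, NormedSpace.exp ((t : ℂ) • A) *ᵥ x
      = ∑ j ∈ Finset.range k, (Complex.exp (t * μ) * (t : ℂ) ^ j) •
        ((j.factorial : ℂ)⁻¹ • ((A - μ • (1 : Matrix n n ℂ)) ^ j *ᵥ x)) := fun t => by
    have e1 : (t : ℂ) • A = (t * μ) • (1 : Matrix n n ℂ)
        + (t : ℂ) • (A - μ • (1 : Matrix n n ℂ)) := by
      rw [smul_sub, smul_smul]
      abel
    have e2 : NormedSpace.exp ((t * μ) • (1 : Matrix n n ℂ))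
        = Complex.exp (t * μ) • (1 : Matrix n n ℂ) := by
      rw [← Algebra.algebraMap_eq_smul_one, ← Algebra.algebraMap_eq_smul_one,
        Complex.exp_eq_exp_ℂ]
      exact (NormedSpace.algebraMap_exp_comm (𝔸 := Matrix n n ℂ) (t * μ : ℂ)).symm
    rw [e1, Matrix.exp_add_of_commute _ _ ((Commute.one_left _).smul_left _), e2,
      smul_mul_assoc, one_mul, smul_mulVec,
      exp_smul_mulVec_of_pow_mulVec_eq_zero _ _ hk', Finset.smul_sum]
    refine Finset.sum_congr rfl fun j _ => ?_
    rw [smul_smul, smul_smul]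
    congr 1
    ring
  change Filter.Tendsto _ _ _
  simp only [e]
  rw [← Finset.sum_const_zero (s := Finset.range k)]
  refine tendsto_finsetSum _ fun j _ => ?_
  simpa using (tendsto_pow_mul_exp_mul_atTop μ hμ j).smul_const
    ((j.factorial : ℂ)⁻¹ • ((A - μ • (1 : Matrix n n ℂ)) ^ j *ᵥ x))

lemma IsHurwitz.tendsto_exp_smul_apply {A : Matrix n n ℝ} (hA : IsHurwitz A) (i j : n) :
    Filter.Tendsto (fun t : ℝ => NormedSpace.exp (t • A) i j) Filter.atTop (nhds 0) := by
  have h1 := tendsto_exp_smul_mulVec _ hA (Pi.single j 1)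
  have h2 := tendsto_pi_nhds.1 h1 i
  have h3 : ∀ t : ℝ, NormedSpace.exp ((t : ℂ) • A.map (algebraMap ℝ ℂ))
      = (NormedSpace.exp (t • A)).map (algebraMap ℝ ℂ) := fun t => by
    have hc : Continuous ((algebraMap ℝ ℂ).mapMatrix : Matrix n n ℝ →+* Matrix n n ℂ) :=
      continuous_id.matrix_map Complex.continuous_ofReal
    have h := NormedSpace.map_exp (algebraMap ℝ ℂ).mapMatrix hc (t • A)
    refine Eq.trans ?_ h.symm
    congr 1
    ext i j
    simp
  simp only [h3, mulVec_single_one, Pi.zero_apply] at h2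
  have h4 := (Complex.continuous_re.tendsto _).comp h2
  simp only [Complex.zero_re] at h4
  refine h4.congr fun t => ?_
  simp

end Exponential
/-! ### Lyapunov's inequality -/

section Lyapunov

lemma mulVec_dotProduct_mulVec_self_le {m n : Type*} [Fintype m] [Fintype n] (E : Matrix m n ℝ) (x : n → ℝ) :
    (E *ᵥ x) ⬝ᵥ (E *ᵥ x) ≤ (∑ i, ∑ j, E i j ^ 2) * (x ⬝ᵥ x) := by
  rw [dotProduct, Finset.sum_mul]
  refine Finset.sum_le_sum fun i _ => ?_
  have h := Finset.sum_mul_sq_le_sq_mul_sq Finset.univ (fun j => E i j) x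
  simp only [mulVec, dotProduct, ← sq]
  exact h

lemma real_dotProduct_self_nonneg {n : Type*} [Fintype n] (x : n → ℝ) : 0 ≤ x ⬝ᵥ x :=
  Finset.sum_nonneg fun _ _ => mul_self_nonneg _

/-- The Gram matrix of a continuous family of matrices over a bounded interval. -/
noncomputable def gram {n : Type*} [Fintype n] (F : ℝ → Matrix n n ℝ) (τ : ℝ) : Matrix n n ℝ :=
  Matrix.of fun i j => ∫ t in (0 : ℝ)..τ, ∑ k, F t k i * F t k j

lemma dotProduct_gram_mulVec {n : Type*} [Fintype n] {F : ℝ → Matrix n n ℝ}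
    (hF : ∀ i j, Continuous fun t => F t i j) (τ : ℝ) (x z : n → ℝ) :
    x ⬝ᵥ (gram F τ *ᵥ z) = ∫ t in (0 : ℝ)..τ, (F t *ᵥ x) ⬝ᵥ (F t *ᵥ z) := by
  have hG : ∀ i j, Continuous fun t => ∑ k, F t k i * F t k j := fun i j =>
    continuous_finsetSum _ fun k _ => (hF k i).mul (hF k j)
  have e : ∀ t : ℝ, (F t *ᵥ x) ⬝ᵥ (F t *ᵥ z)
      = ∑ i, ∑ j, x i * ((∑ k, F t k i * F t k j) * z j) := fun t => by
    have h : ∀ i j, ∑ k, F t k i * F t k j = ((F t)ᵀ * F t) i j := fun i j => rfl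
    simp only [h, ← Finset.mul_sum]
    change _ = x ⬝ᵥ (((F t)ᵀ * F t) *ᵥ z)
    rw [← mulVec_mulVec, dotProduct_mulVec x, vecMul_transpose]
  have h1 : ∀ i j, IntervalIntegrable (fun t => x i * ((∑ k, F t k i * F t k j) * z j))
      volume 0 τ := fun i j =>
    (continuous_const.mul ((hG i j).mul continuous_const)).intervalIntegrable _ _
  have h2 : ∀ i, IntervalIntegrable (fun t => ∑ j, x i * ((∑ k, F t k i * F t k j) * z j))
      volume 0 τ := fun i => (continuous_finsetSum _ fun j _ =>
    continuous_const.mul ((hG i j).mul continuous_const)).intervalIntegrable _ _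
  simp only [e]
  rw [intervalIntegral.integral_finsetSum fun i _ => h2 i]
  refine Finset.sum_congr rfl fun i _ => ?_
  rw [intervalIntegral.integral_finsetSum fun j _ => h1 i j]
  simp only [intervalIntegral.integral_const_mul, intervalIntegral.integral_mul_const,
    ← Finset.mul_sum]
  rfl

variable {n : Type*} [Fintype n] [DecidableEq n]

lemma continuous_exp_smul_mulVec (A : Matrix n n ℝ) (x : n → ℝ) :
    Continuous fun t : ℝ => NormedSpace.exp (t • A) *ᵥ x :=
  continuous_iff_continuousAt.2 fun t => (hasDerivAt_exp_smul_mulVec A x t).continuousAt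

lemma exp_smul_mulVec_mulVec (A : Matrix n n ℝ) (x : n → ℝ) (t : ℝ) :
    NormedSpace.exp (t • A) *ᵥ (A *ᵥ x) = A *ᵥ (NormedSpace.exp (t • A) *ᵥ x) := by
  have h1 : Commute (t • A) A := (Commute.refl A).smul_left t
  have h2 : Commute (NormedSpace.exp (t • A)) A := by
    let := Matrix.linftyOpNormedRing (n := n) (α := ℝ)
    let := Matrix.linftyOpNormedAlgebra (n := n) (R := ℝ) (α := ℝ)
    exact h1.exp_left
  rw [mulVec_mulVec, mulVec_mulVec, h2.eq]

lemma exp_smul_mul_exp_neg_smul (A : Matrix n n ℝ) (t : ℝ) :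
    NormedSpace.exp (t • A) * NormedSpace.exp (-(t • A)) = 1 := by
  rw [← Matrix.exp_add_of_commute _ _ (Commute.refl (t • A)).neg_right, add_neg_cancel,
    NormedSpace.exp_zero]

lemma isSolution_exp_smul {m : Type*} [Fintype m] (A : Matrix n n ℝ) (x : n → ℝ) :
    IsSolution A (0 : Matrix n m ℝ) 0 (fun t => NormedSpace.exp (t • A) *ᵥ x) := fun i => by
  have h := fun t => hasDerivAt_pi.1 (hasDerivAt_exp_smul_mulVec A x t) i
  refine (IsPrimitive.of_hasDerivAt h ?_).congr_deriv fun t _ => by simp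
  have := continuous_exp_smul_mulVec A x
  fun_prop

/-- `P` is the integral of `exp(tA)ᵀ exp(tA)` over a finite interval `[0, τ]`. Its Lyapunov
derivative is `|exp(τA)x|² - |x|²`, so convergence of `exp(tA)` to zero suffices and no decay rate
is needed. -/
lemma IsHurwitz.exists_lyapunov {A : Matrix n n ℝ} (hA : IsHurwitz A) :
    ∃ P : Matrix n n ℝ, (∀ x, 0 ≤ x ⬝ᵥ (P *ᵥ x)) ∧
      ∀ x, (A *ᵥ x) ⬝ᵥ (P *ᵥ x) + x ⬝ᵥ (P *ᵥ (A *ᵥ x)) ≤ -(1 / 2) * (x ⬝ᵥ x) := by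
  have h1 : Filter.Tendsto (fun t : ℝ => ∑ i, ∑ j, NormedSpace.exp (t • A) i j ^ 2)
      Filter.atTop (nhds 0) := by
    have := tendsto_finsetSum Finset.univ fun (i : n) _ => tendsto_finsetSum Finset.univ
      fun (j : n) _ => (hA.tendsto_exp_smul_apply i j).pow 2
    simpa using this
  -- At `τ` the squared Frobenius norm of `exp(τA)` is at most `1/2`.
  obtain ⟨τ, hτ0, hτ⟩ := ((Filter.eventually_ge_atTop (0 : ℝ)).and
    (h1.eventually (ge_mem_nhds (by norm_num : (0 : ℝ) < 1 / 2)))).exists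
  refine ⟨gram (fun t => NormedSpace.exp (t • A)) τ, fun x => ?_, fun x => ?_⟩
  · rw [dotProduct_gram_mulVec (continuous_exp_smul_apply A)]
    exact intervalIntegral.integral_nonneg hτ0 fun t _ => real_dotProduct_self_nonneg _
  · have hc := continuous_exp_smul_mulVec A
    -- The fundamental theorem for `|exp(tA)x|²` on `[0, τ]`.
    have h2 := ((isSolution_exp_smul (m := n) A x).bilinear
      (isSolution_exp_smul (m := n) A x) 1).eq_integral τ hτ0
    simp only [Pi.zero_apply, mulVec_zero, add_zero, one_mulVec, zero_smul,
      NormedSpace.exp_zero] at h2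
    rw [dotProduct_gram_mulVec (continuous_exp_smul_apply A),
      dotProduct_gram_mulVec (continuous_exp_smul_apply A), ← intervalIntegral.integral_add
      (((hc (A *ᵥ x)).dotProduct (hc x)).intervalIntegrable _ _)
      (((hc x).dotProduct (hc (A *ᵥ x))).intervalIntegrable _ _)]
    simp only [exp_smul_mulVec_mulVec]
    have h3 := mulVec_dotProduct_mulVec_self_le (NormedSpace.exp (τ • A)) x
    have h4 : 0 ≤ x ⬝ᵥ x := real_dotProduct_self_nonneg x
    nlinarith

end Lyapunov

/-! ### Square integrable signals -/

/-- All components of the signal `u` are square integrable on `[0, ∞)`. -/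
def SquareIntegrable {m : Type*} (u : ℝ → m → ℝ) : Prop :=
  ∀ j, MemLp (fun t => u t j) 2 halfLine

namespace SquareIntegrable

variable {m p : Type*} {u v : ℝ → m → ℝ}

lemma add (hu : SquareIntegrable u) (hv : SquareIntegrable v) :
    SquareIntegrable fun t => u t + v t := fun j => (hu j).add (hv j)

lemma sub (hu : SquareIntegrable u) (hv : SquareIntegrable v) :
    SquareIntegrable fun t => u t - v t := fun j => (hu j).sub (hv j)

lemma mulVec [Fintype m] (hu : SquareIntegrable u) (Q : Matrix p m ℝ) :
    SquareIntegrable fun t => Q *ᵥ u t := fun i => by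
  simp only [Matrix.mulVec, dotProduct]
  exact memLp_finsetSum _ fun j _ => (hu j).const_mul (Q i j)

lemma integrable_dotProduct [Fintype m] (hu : SquareIntegrable u) (hv : SquareIntegrable v) :
    Integrable (fun t => u t ⬝ᵥ v t) halfLine := by
  simp only [dotProduct]
  exact integrable_finsetSum _ fun j _ => (hu j).integrable_mul (hv j)

lemma intervalIntegrable (hu : SquareIntegrable u) (j : m) {T : ℝ} (hT : 0 ≤ T) :
    IntervalIntegrable (fun t => u t j) volume 0 T := by
  rw [intervalIntegrable_iff_integrableOn_Icc_of_le hT]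
  have h : MemLp (fun t => u t j) 2 (volume.restrict (Set.Icc 0 T)) :=
    (hu j).mono_measure (Measure.restrict_mono Set.Icc_subset_Ici_self le_rfl)
  exact h.integrable (by norm_num)

end SquareIntegrable

namespace IsSolution

variable {n m : Type*} [Fintype n] [Fintype m] {A : Matrix n n ℝ}
  {B : Matrix n m ℝ} {u : ℝ → m → ℝ} {ξ : ℝ → n → ℝ}

/-- With the Lyapunov function `V = ξᵀPξ ≥ 0`, the estimate `V' ≤ -|ξ|²/4 + |v|²` integrates to a
bound on `∫₀ᵀ |ξ|²` independent of `T`. -/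
lemma squareIntegrable [DecidableEq n] (hA : IsHurwitz A) (hξ : IsSolution A B u ξ) (hu : SquareIntegrable u) :
    SquareIntegrable ξ := by
  obtain ⟨P, hP0, hP⟩ := hA.exists_lyapunov
  have hV := hξ.bilinear hξ P
  -- The input enters `V'` as `ξᵀv`; the sum `Pᵀ + P` makes symmetry of `P` unnecessary.
  set v : ℝ → n → ℝ := fun t => ((Pᵀ + P) * B) *ᵥ u t with hvdef
  have hv : SquareIntegrable v := hu.mulVec _
  have hvv : IntegrableOn (fun t => v t ⬝ᵥ v t) (Set.Ioi 0) :=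
    IntegrableOn.mono_set (t := Set.Ici 0) (hv.integrable_dotProduct hv) Set.Ioi_subset_Ici_self
  have hξξ : ∀ T : ℝ, 0 ≤ T → IntervalIntegrable (fun t => ξ t ⬝ᵥ ξ t) volume 0 T :=
    fun T hT => by
      simpa using ((hξ.bilinear hξ 1).intervalIntegrable_self hT)
  have hle : ∀ t, (A *ᵥ ξ t + B *ᵥ u t) ⬝ᵥ (P *ᵥ ξ t)
      + ξ t ⬝ᵥ (P *ᵥ (A *ᵥ ξ t + B *ᵥ u t)) ≤ -(1 / 4) * (ξ t ⬝ᵥ ξ t) + v t ⬝ᵥ v t := fun t => by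
    have h1 := hP (ξ t)
    have h2 : (B *ᵥ u t) ⬝ᵥ (P *ᵥ ξ t) + ξ t ⬝ᵥ (P *ᵥ (B *ᵥ u t)) = ξ t ⬝ᵥ v t := by
      simp only [hvdef, ← mulVec_mulVec, add_mulVec, dotProduct_add]
      congr 1
      rw [dotProduct_mulVec, ← mulVec_transpose, dotProduct_comm]
    have h3 : ξ t ⬝ᵥ v t ≤ (1 / 4) * (ξ t ⬝ᵥ ξ t) + v t ⬝ᵥ v t := by
      simp only [dotProduct, Finset.mul_sum, ← Finset.sum_add_distrib]
      exact Finset.sum_le_sum fun i _ => by nlinarith [sq_nonneg (ξ t i / 2 - v t i)]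
    simp only [mulVec_add, add_dotProduct, dotProduct_add] at *
    linarith
  have hbound : ∀ T : ℝ, 0 ≤ T → ∫ t in (0 : ℝ)..T, ‖ξ t ⬝ᵥ ξ t‖
      ≤ 4 * (ξ 0 ⬝ᵥ (P *ᵥ ξ 0) + ∫ t in Set.Ioi 0, v t ⬝ᵥ v t) := fun T hT => by
    have hvT : IntervalIntegrable (fun t => v t ⬝ᵥ v t) volume 0 T :=
      (intervalIntegrable_iff_integrableOn_Ioc_of_le hT).2
        (hvv.mono_set Set.Ioc_subset_Ioi_self)
    have h1 := hV.eq_integral T hT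
    have h2 := intervalIntegral.integral_mono_on hT (hV.intervalIntegrable T hT)
      (((hξξ T hT).const_mul (-(1 / 4))).add hvT) fun t _ => hle t
    rw [intervalIntegral.integral_add ((hξξ T hT).const_mul _) hvT,
      intervalIntegral.integral_const_mul] at h2
    have h3 : ∫ t in (0 : ℝ)..T, v t ⬝ᵥ v t ≤ ∫ t in Set.Ioi 0, v t ⬝ᵥ v t := by
      rw [intervalIntegral.integral_of_le hT]
      exact setIntegral_mono_set hvv (Filter.Eventually.of_forall fun _ =>
        real_dotProduct_self_nonneg _) (Filter.Eventually.of_forall Set.Ioc_subset_Ioi_self)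
    have h4 : ∀ t, ‖ξ t ⬝ᵥ ξ t‖ = ξ t ⬝ᵥ ξ t := fun t =>
      Real.norm_of_nonneg (real_dotProduct_self_nonneg _)
    simp only [h4]
    have h5 := hP0 (ξ T)
    linarith
  have hint : IntegrableOn (fun t => ξ t ⬝ᵥ ξ t) (Set.Ioi 0) := by
    refine integrableOn_Ioi_of_intervalIntegral_norm_bounded
      (4 * (ξ 0 ⬝ᵥ (P *ᵥ ξ 0) + ∫ t in Set.Ioi 0, v t ⬝ᵥ v t)) 0 (l := Filter.atTop) (b := id)
      (fun T => ?_) Filter.tendsto_id ?_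
    · rcases le_total 0 T with hT | hT
      · exact (intervalIntegrable_iff_integrableOn_Ioc_of_le hT).1 (hξξ T hT)
      · simp [Set.Ioc_eq_empty (not_lt.2 hT)]
    · filter_upwards [Filter.eventually_ge_atTop 0] with T hT
      exact hbound T hT
  have hint' : IntegrableOn (fun t => ξ t ⬝ᵥ ξ t) (Set.Ici 0) :=
    (integrableOn_Ici_iff_integrableOn_Ioi (by simp)).2 hint
  intro i
  have hm : AEStronglyMeasurable (fun t => ξ t i) halfLine :=
    (hξ i).continuousOn.aestronglyMeasurable measurableSet_Ici
  rw [memLp_two_iff_integrable_sq hm]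
  refine Integrable.mono' hint' (hm.pow 2)
    (Filter.Eventually.of_forall fun t => ?_)
  rw [Real.norm_of_nonneg (sq_nonneg _), sq]
  exact Finset.single_le_sum (f := fun i => ξ t i * ξ t i) (fun j _ => mul_self_nonneg _)
    (Finset.mem_univ i)

lemma intervalIntegrable_mulVec {p : Type*} {F : ℝ → Matrix p m ℝ}
    (hF : ∀ i j, Continuous fun t => F t i j) {a b : ℝ}
    (hu : ∀ j, IntervalIntegrable (fun t => u t j) volume a b) (i : p) :
    IntervalIntegrable (fun t => (F t *ᵥ u t) i) volume a b := by
  have e : (fun t => (F t *ᵥ u t) i) = ∑ j, fun t => F t i j * u t j := by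
    funext t
    rw [Finset.sum_apply]
    rfl
  rw [e]
  exact IntervalIntegrable.sum _ fun j _ => (hu j).continuousOn_mul (hF i j).continuousOn

/-- Variation of constants: `ξ(t) = exp(tA) c(t)` with `c' = exp(-tA)Bu`. -/
lemma exists_of_intervalIntegrable [DecidableEq n] (A : Matrix n n ℝ) (B : Matrix n m ℝ)
    (hu : ∀ T : ℝ, 0 ≤ T → ∀ j, IntervalIntegrable (fun t => u t j) volume 0 T) (x : n → ℝ) :
    ∃ ξ, IsSolution A B u ξ ∧ ξ 0 = x := by
  let g : n → ℝ → ℝ := fun j s => (NormedSpace.exp (-(s • A)) *ᵥ (B *ᵥ u s)) j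
  let c : ℝ → n → ℝ := fun t j => x j + ∫ s in (0 : ℝ)..t, g j s
  have hneg : ∀ i j, Continuous fun s : ℝ => NormedSpace.exp (-(s • A)) i j := fun i j => by
    simpa only [← smul_neg] using continuous_exp_smul_apply (-A) i j
  have hc : ∀ j, IsPrimitive (fun t => c t j) (g j) := fun j =>
    ⟨fun T hT => intervalIntegrable_mulVec (F := fun s => NormedSpace.exp (-(s • A)))
      (u := fun s => B *ᵥ u s) hneg (intervalIntegrable_mulVec (F := fun _ => B)
      (fun _ _ => continuous_const) (hu T hT)) j, fun T _ => by
        simp only [c, intervalIntegral.integral_same, add_zero]⟩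
  have hE : ∀ i j, IsPrimitive (fun t : ℝ => NormedSpace.exp (t • A) i j)
      (fun t => (A * NormedSpace.exp (t • A)) i j) := fun i j => by
    refine IsPrimitive.of_hasDerivAt (hasDerivAt_exp_smul_apply A i j) ?_
    exact continuous_finsetSum _ fun k _ =>
      continuous_const.mul (continuous_exp_smul_apply A k j)
  refine ⟨fun t => NormedSpace.exp (t • A) *ᵥ c t, fun i => ?_, ?_⟩
  · refine (IsPrimitive.sum Finset.univ fun j => (hE i j).mul (hc j)).congr_deriv fun t _ => ?_
    rw [Finset.sum_add_distrib, Pi.add_apply, mulVec_mulVec]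
    congr 1
    change (NormedSpace.exp (t • A) *ᵥ (NormedSpace.exp (-(t • A)) *ᵥ (B *ᵥ u t))) i = _
    rw [mulVec_mulVec, exp_smul_mul_exp_neg_smul, one_mulVec]
  · funext i
    simp [c, NormedSpace.exp_zero]

end IsSolution

open scoped SchwartzMap

/-! ### Fourier transforms of square integrable signals on the half line -/

/-- The extension by zero of a real signal on `[0, ∞)`, with complex values. -/
noncomputable def extendReal (f : ℝ → ℝ) : ℝ → ℂ := (Set.Ici (0 : ℝ)).indicator fun t => (f t : ℂ)

lemma memLp_extendReal {f : ℝ → ℝ} (hf : MemLp f 2 halfLine) :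
    MemLp (extendReal f) 2 (volume : Measure ℝ) := by
  unfold extendReal
  rw [memLp_indicator_iff_restrict measurableSet_Ici]
  exact hf.ofReal

/-- The Fourier transform of a square integrable real signal on `[0, ∞)`. -/
noncomputable def halfLineFourier {f : ℝ → ℝ} (hf : MemLp f 2 halfLine) : Lp ℂ 2 (volume : Measure ℝ) :=
  𝓕 ((memLp_extendReal hf).toLp (extendReal f))

lemma integral_mul_extendReal (g : ℝ → ℂ) (f : ℝ → ℝ) :
    ∫ t, g t * extendReal f t = ∫ t in Set.Ici 0, g t * f t := by
  rw [← integral_indicator measurableSet_Ici]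
  congr 1
  ext t
  by_cases ht : t ∈ Set.Ici (0 : ℝ) <;> simp [extendReal, ht]

lemma integral_schwartz_mul_fourier {E : Type*} [NormedAddCommGroup E] [InnerProductSpace ℂ E]
    [CompleteSpace E] (f : Lp E 2 (volume : Measure ℝ)) (φ : 𝓢(ℝ, ℂ)) :
    ∫ ω, φ ω • (𝓕 f : Lp E 2 (volume : Measure ℝ)) ω = ∫ t, (𝓕 φ) t • f t := by
  have h := congrArg (fun F : 𝓢'(ℝ, E) => F φ) (Lp.fourier_toTemperedDistribution_eq f)
  simp only [TemperedDistribution.fourier_apply, Lp.toTemperedDistribution_apply] at h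
  exact h.symm

lemma integral_schwartz_mul_halfLineFourier {f : ℝ → ℝ} (hf : MemLp f 2 halfLine)
    (φ : 𝓢(ℝ, ℂ)) :
    ∫ ω, φ ω * halfLineFourier hf ω = ∫ t in Set.Ici 0, (𝓕 φ) t * (f t : ℂ) := by
  have h := integral_schwartz_mul_fourier ((memLp_extendReal hf).toLp (extendReal f)) φ
  simp only [smul_eq_mul] at h
  rw [halfLineFourier, h, ← integral_mul_extendReal]
  refine integral_congr_ae ?_
  filter_upwards [(memLp_extendReal hf).coeFn_toLp] with t ht
  rw [ht]

/-- An `L₂` transform is only a class, so identities for it are checked against Schwartz functions;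
smooth compactly supported ones already separate locally integrable functions. -/
lemma halfLineFourier_ae_eq {f : ℝ → ℝ} (hf : MemLp f 2 halfLine) {g : ℝ → ℂ}
    (hg : LocallyIntegrable g)
    (h : ∀ φ : 𝓢(ℝ, ℂ), ∫ ω, φ ω * g ω = ∫ t in Set.Ici 0, (𝓕 φ) t * (f t : ℂ)) :
    halfLineFourier hf =ᵐ[volume] g := by
  refine ae_eq_of_integral_contDiff_smul_eq
    ((Lp.memLp (halfLineFourier hf)).locallyIntegrable (by norm_num)) hg fun ψ hψ hs => ?_
  have hs' : HasCompactSupport fun x => (ψ x : ℂ) := hs.comp_left Complex.ofReal_zero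
  have hψ' : ContDiff ℝ ((⊤ : ℕ∞) : WithTop ℕ∞) fun x => (ψ x : ℂ) := Complex.ofRealCLM.contDiff.comp hψ
  have h1 := h (hs'.toSchwartzMap hψ')
  rw [← integral_schwartz_mul_halfLineFourier hf] at h1
  simpa using h1.symm

lemma halfLineFourier_sum {ι : Type*} [Fintype ι] {f : ι → ℝ → ℝ}
    (hf : ∀ i, MemLp (f i) 2 halfLine) (c : ι → ℝ)
    (h : MemLp (fun t => ∑ i, c i * f i t) 2 halfLine) :
    halfLineFourier h =ᵐ[volume] fun ω => ∑ i, (c i : ℂ) * halfLineFourier (hf i) ω := by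
  refine halfLineFourier_ae_eq h ?_ fun φ => ?_
  · refine MemLp.locallyIntegrable (p := 2) ?_ (by norm_num)
    exact memLp_finsetSum _ fun i _ => (Lp.memLp (halfLineFourier (hf i))).const_mul _
  · have h1 : ∀ i, Integrable fun ω => (c i : ℂ) * (φ ω * halfLineFourier (hf i) ω) := fun i =>
      ((φ.memLp 2).integrable_mul (Lp.memLp (halfLineFourier (hf i)))).const_mul _
    have h2 : ∀ i, Integrable (fun t => (c i : ℂ) * ((𝓕 φ) t * f i t)) halfLine := fun i =>
      ((((𝓕 φ).memLp 2).mono_measure Measure.restrict_le_self).integrable_mul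
        (hf i).ofReal).const_mul _
    have e1 : ∀ ω, φ ω * ∑ i, (c i : ℂ) * halfLineFourier (hf i) ω
        = ∑ i, (c i : ℂ) * (φ ω * halfLineFourier (hf i) ω) := fun ω => by
      rw [Finset.mul_sum]
      exact Finset.sum_congr rfl fun i _ => by ring
    have e2 : ∀ t, (𝓕 φ) t * ((∑ i, c i * f i t : ℝ) : ℂ)
        = ∑ i, (c i : ℂ) * ((𝓕 φ) t * f i t) := fun t => by
      push_cast
      rw [Finset.mul_sum]
      exact Finset.sum_congr rfl fun i _ => by ring
    simp only [e1, e2]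
    rw [integral_finsetSum _ fun i _ => h1 i, integral_finsetSum _ fun i _ => h2 i]
    refine Finset.sum_congr rfl fun i _ => ?_
    rw [integral_const_mul, integral_const_mul, integral_schwartz_mul_halfLineFourier]

lemma integral_deriv_mul_add_mul_deriv_eq_zero {f f' g g' : ℝ → ℝ} (hf : IsPrimitive f f')
    (hg : IsPrimitive g g') (hf2 : MemLp f 2 halfLine) (hf2' : MemLp f' 2 halfLine)
    (hg2 : MemLp g 2 halfLine) (hg2' : MemLp g' 2 halfLine) (h0 : f 0 = 0) :
    ∫ t in Set.Ici 0, (g' t * f t + g t * f' t) = 0 := by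
  have hint : ∀ {a b : ℝ → ℝ}, MemLp a 2 halfLine → MemLp b 2 halfLine →
      IntegrableOn (fun t => a t * b t) (Set.Ioi 0) := fun ha hb =>
    IntegrableOn.mono_set (t := Set.Ici 0) (ha.integrable_mul hb) Set.Ioi_subset_Ici_self
  rw [integral_Ici_eq_integral_Ioi, (hg.mul hf).integral_deriv_eq_neg (hint hg2 hf2)
    ((hint hg2' hf2).add (hint hg2 hf2')), h0, mul_zero, neg_zero]

lemma integral_schwartz_deriv_mul {f f' : ℝ → ℝ} (hf : IsPrimitive f f')
    (hf2 : MemLp f 2 halfLine) (hf2' : MemLp f' 2 halfLine) (h0 : f 0 = 0) (ψ : 𝓢(ℝ, ℂ)) :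
    ∫ t in Set.Ici 0, SchwartzMap.derivCLM ℂ ℂ ψ t * f t
      = -∫ t in Set.Ici 0, ψ t * f' t := by
  have m1 : MemLp ψ 2 halfLine := (ψ.memLp 2).mono_measure Measure.restrict_le_self
  have m2 : MemLp (SchwartzMap.derivCLM ℂ ℂ ψ) 2 halfLine :=
    ((SchwartzMap.derivCLM ℂ ℂ ψ).memLp 2).mono_measure Measure.restrict_le_self
  have hd : ∀ t, HasDerivAt ψ (SchwartzMap.derivCLM ℂ ℂ ψ t) t := fun t => by
    simpa using ψ.differentiableAt.hasDerivAt
  have i1 : Integrable (fun t => SchwartzMap.derivCLM ℂ ℂ ψ t * f t) halfLine :=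
    m2.integrable_mul hf2.ofReal
  have i2 : Integrable (fun t => ψ t * f' t) halfLine := m1.integrable_mul hf2'.ofReal
  rw [eq_neg_iff_add_eq_zero, ← integral_add i1 i2]
  -- Primitives are real-valued here, so real and imaginary parts of `ψ` are treated separately.
  have key : ∀ L : ℂ →L[ℝ] ℝ, (∀ (z : ℂ) (r : ℝ), L (z * r) = L z * r) →
      L (∫ t in Set.Ici 0, (SchwartzMap.derivCLM ℂ ℂ ψ t * f t + ψ t * f' t)) = 0 :=
    fun L hL => by
      have h1 := L.integral_comp_comm (i1.add i2)
      simp only [Pi.add_apply] at h1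
      rw [← h1]
      simp only [map_add, hL]
      exact integral_deriv_mul_add_mul_deriv_eq_zero hf (g := fun t => L (ψ t))
        (IsPrimitive.of_hasDerivAt (fun t => L.hasFDerivAt.comp_hasDerivAt t (hd t))
          (L.continuous.comp (SchwartzMap.derivCLM ℂ ℂ ψ).continuous)) hf2 hf2'
        (L.comp_memLp' m1) (L.comp_memLp' m2) h0
  refine Complex.ext ?_ ?_
  · exact key Complex.reCLM fun z r => by simp
  · exact key Complex.imCLM fun z r => by simp

/-- As `f 0 = 0`, extension by zero creates no jump at the origin, hence no boundary term. The
factor `2π` comes from the kernel `exp(-2πiωt)`. -/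
lemma halfLineFourier_deriv {f f' : ℝ → ℝ} (hf : IsPrimitive f f')
    (hf2 : MemLp f 2 halfLine) (hf2' : MemLp f' 2 halfLine) (h0 : f 0 = 0) :
    halfLineFourier hf2' =ᵐ[volume]
      fun ω => (Complex.I * (2 * Real.pi * ω : ℝ)) * halfLineFourier hf2 ω := by
  refine halfLineFourier_ae_eq hf2' ?_ fun φ => ?_
  · have h1 := (Lp.memLp (halfLineFourier hf2)).locallyIntegrable (by norm_num)
    refine (locallyIntegrableOn_univ.1 ?_)
    exact (locallyIntegrableOn_univ.2 h1).continuousOn_mul (by fun_prop) isOpen_univ.isLocallyClosed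
  -- The factor `2πiω` is moved onto the test function, whose transform then becomes `-(𝓕 φ)'`.
  · set χ : 𝓢(ℝ, ℂ) := (2 * Real.pi * Complex.I) • SchwartzMap.smulLeftCLM ℂ (inner ℝ · (1 : ℝ)) φ
      with hχ
    have htg : (inner ℝ · (1 : ℝ) : ℝ → ℝ).HasTemperateGrowth :=
      ((innerSL ℝ).flip (1 : ℝ)).hasTemperateGrowth
    have e1 : ∀ ω, φ ω * (Complex.I * (2 * Real.pi * ω : ℝ) * halfLineFourier hf2 ω)
        = χ ω * halfLineFourier hf2 ω := fun ω => by
      rw [hχ, _root_.smul_apply, SchwartzMap.smulLeftCLM_apply_apply htg]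
      simp
      ring
    have e2 : 𝓕 χ = -SchwartzMap.derivCLM ℂ ℂ (𝓕 φ) := by
      have h1 := SchwartzMap.lineDerivOp_fourier_eq φ (1 : ℝ)
      rw [neg_smul, ← hχ, FourierTransform.fourier_neg] at h1
      rw [← neg_eq_iff_eq_neg, ← h1]
      ext t
      simp [SchwartzMap.lineDerivOp_apply_eq_fderiv]
    simp only [e1]
    rw [integral_schwartz_mul_halfLineFourier hf2, e2]
    have h2 := integral_schwartz_deriv_mul hf hf2 hf2' h0 (𝓕 φ)
    rw [← neg_eq_iff_eq_neg] at h2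
    rw [← h2, ← integral_neg]
    simp

lemma integral_star_halfLineFourier_mul {f g : ℝ → ℝ} (hf : MemLp f 2 halfLine)
    (hg : MemLp g 2 halfLine) :
    ∫ ω, star (halfLineFourier hf ω) * halfLineFourier hg ω
      = ((∫ t in Set.Ici 0, f t * g t : ℝ) : ℂ) := by
  have h := Lp.inner_fourier_eq ((memLp_extendReal hf).toLp (extendReal f))
    ((memLp_extendReal hg).toLp (extendReal g))
  rw [L2.inner_def, L2.inner_def] at h
  simp only [RCLike.inner_apply] at h
  have e1 : ∫ ω, star (halfLineFourier hf ω) * halfLineFourier hg ω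
      = ∫ ω, halfLineFourier hg ω * (starRingEnd ℂ) (halfLineFourier hf ω) := by
    refine integral_congr_ae (Filter.Eventually.of_forall fun ω => ?_)
    exact mul_comm _ _
  rw [e1]
  refine h.trans ?_
  rw [← integral_complex_ofReal, ← integral_indicator measurableSet_Ici]
  refine integral_congr_ae ?_
  filter_upwards [(memLp_extendReal hf).coeFn_toLp, (memLp_extendReal hg).coeFn_toLp]
    with t h1 h2
  rw [h1, h2]
  by_cases ht : t ∈ Set.Ici (0 : ℝ)
  · simp [extendReal, Set.indicator_of_mem ht, mul_comm]
  · simp [extendReal, Set.indicator_of_notMem ht]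

/-- Continuous functionals pass through the pairing with test functions. With coordinate projections
this reduces vector-valued transforms to scalar ones. -/
lemma clm_fourier_ae_eq_halfLineFourier {E : Type*} [NormedAddCommGroup E] [InnerProductSpace ℂ E]
    [CompleteSpace E] (G : Lp E 2 (volume : Measure ℝ)) (L : E →L[ℂ] ℂ) {f : ℝ → ℝ}
    (hf : MemLp f 2 halfLine) (hG : ∀ᵐ t, L (G t) = extendReal f t) :
    (fun ω => L ((𝓕 G : Lp E 2 (volume : Measure ℝ)) ω)) =ᵐ[volume] halfLineFourier hf := by
  have hF : MemLp (fun ω => L ((𝓕 G : Lp E 2 (volume : Measure ℝ)) ω)) 2 volume :=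
    L.comp_memLp' (Lp.memLp _)
  refine (halfLineFourier_ae_eq hf (hF.locallyIntegrable (by norm_num)) fun φ => ?_).symm
  have h := congrArg L (integral_schwartz_mul_fourier G φ)
  have i1 : Integrable fun ω => φ ω • (𝓕 G : Lp E 2 (volume : Measure ℝ)) ω :=
    memLp_one_iff_integrable.1 ((Lp.memLp _).smul (φ.memLp 2))
  have i2 : Integrable fun t => (𝓕 φ) t • G t :=
    memLp_one_iff_integrable.1 ((Lp.memLp _).smul ((𝓕 φ).memLp 2))
  rw [← L.integral_comp_comm i1, ← L.integral_comp_comm i2] at h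
  simp only [map_smul, smul_eq_mul] at h
  refine h.trans ?_
  rw [← integral_mul_extendReal]
  refine integral_congr_ae ?_
  filter_upwards [hG] with t ht
  rw [ht]

lemma fourier_toLp_extendZero_apply {ι : Type*} [Fintype ι] {x : L2e ι} (hx : IsL2 x) (i : ι)
    (hi : MemLp (fun t => x t i) 2 halfLine) :
    (fun ω => (𝓕 ((memLp_extendZero hx).toLp (extendZero x)) :
      Lp (EuclideanSpace ℂ ι) 2 (volume : Measure ℝ)) ω i) =ᵐ[volume] halfLineFourier hi := by
  refine clm_fourier_ae_eq_halfLineFourier _ (EuclideanSpace.proj i) hi ?_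
  filter_upwards [(memLp_extendZero hx).coeFn_toLp] with t ht
  rw [ht]
  by_cases h0 : t ∈ Set.Ici (0 : ℝ) <;> simp [extendZero, extendReal, h0]

/-! ### Parseval's identity for state space systems -/

lemma halfLineFourier_congr {f g : ℝ → ℝ} (hf : MemLp f 2 halfLine) (hg : MemLp g 2 halfLine)
    (h : f = g) : halfLineFourier hf = halfLineFourier hg := by
  subst h
  rfl

/-- The componentwise Fourier transform of a square integrable signal. -/
noncomputable def SquareIntegrable.fourier {m : Type*} {u : ℝ → m → ℝ} (hu : SquareIntegrable u) (w : ℝ) :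
    m → ℂ :=
  fun j => halfLineFourier (hu j) w

lemma SquareIntegrable.fourier_mulVec_add {n m p : Type*} [Fintype n] [Fintype m] [Fintype p]
    {ξ : ℝ → n → ℝ} {u : ℝ → m → ℝ} (hξ : SquareIntegrable ξ) (hu : SquareIntegrable u)
    (P : Matrix p n ℝ) (Q : Matrix p m ℝ) (h : SquareIntegrable fun t => P *ᵥ ξ t + Q *ᵥ u t) :
    ∀ᵐ w, h.fourier w
      = P.map (algebraMap ℝ ℂ) *ᵥ hξ.fourier w + Q.map (algebraMap ℝ ℂ) *ᵥ hu.fourier w := by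
  have hk : ∀ k, ∀ᵐ w, h.fourier w k = (P.map (algebraMap ℝ ℂ) *ᵥ hξ.fourier w
      + Q.map (algebraMap ℝ ℂ) *ᵥ hu.fourier w) k := fun k => by
    have hf : ∀ i : n ⊕ m, MemLp (Sum.elim (fun i t => ξ t i) (fun j t => u t j) i) 2 halfLine :=
      fun i => by
        rcases i with i | j
        · exact hξ i
        · exact hu j
    have e : (fun t => (P *ᵥ ξ t + Q *ᵥ u t) k) = fun t => ∑ i : n ⊕ m,
        Sum.elim (P k) (Q k) i * Sum.elim (fun i t => ξ t i) (fun j t => u t j) i t := by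
      funext t
      rw [Fintype.sum_sum_type]
      rfl
    have h1 := halfLineFourier_sum hf (Sum.elim (P k) (Q k)) (e ▸ h k)
    rw [← halfLineFourier_congr (h k) _ e] at h1
    filter_upwards [h1] with w hw
    refine hw.trans ?_
    rw [Fintype.sum_sum_type]
    rfl
  filter_upwards [ae_all_iff.2 hk] with w hw
  exact funext hw

lemma SquareIntegrable.integral_dotProduct_mulVec {p : Type*} [Fintype p] {y : ℝ → p → ℝ}
    (hy : SquareIntegrable y) (M : Matrix p p ℝ) :
    ∫ t in Set.Ici 0, y t ⬝ᵥ (M *ᵥ y t)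
      = ∫ w, (star (hy.fourier w) ⬝ᵥ (M.map (algebraMap ℝ ℂ) *ᵥ hy.fourier w)).re := by
  have i1 : ∀ k l, Integrable fun w => (M k l : ℂ) *
      (star (halfLineFourier (hy k) w) * halfLineFourier (hy l) w) := fun k l =>
    (MemLp.integrable_mul (Lp.memLp (halfLineFourier (hy k))).star
      (Lp.memLp (halfLineFourier (hy l)))).const_mul _
  have i2 : ∀ k l, Integrable (fun t => M k l * (y t k * y t l)) halfLine := fun k l =>
    ((hy k).integrable_mul (hy l)).const_mul _
  have e1 : ∀ w, star (hy.fourier w) ⬝ᵥ (M.map (algebraMap ℝ ℂ) *ᵥ hy.fourier w)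
      = ∑ k, ∑ l, (M k l : ℂ) *
        (star (halfLineFourier (hy k) w) * halfLineFourier (hy l) w) := fun w => by
    simp only [dotProduct, Matrix.mulVec, Finset.mul_sum]
    refine Finset.sum_congr rfl fun k _ => Finset.sum_congr rfl fun l _ => ?_
    simp only [SquareIntegrable.fourier, Pi.star_apply, map_apply, Complex.coe_algebraMap]
    ring
  have e2 : ∀ t, y t ⬝ᵥ (M *ᵥ y t) = ∑ k, ∑ l, M k l * (y t k * y t l) := fun t => by
    simp only [dotProduct, Matrix.mulVec, Finset.mul_sum]
    exact Finset.sum_congr rfl fun k _ => Finset.sum_congr rfl fun l _ => by ring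
  have i3 : Integrable fun w =>
      star (hy.fourier w) ⬝ᵥ (M.map (algebraMap ℝ ℂ) *ᵥ hy.fourier w) := by
    simp only [e1]
    exact integrable_finsetSum _ fun k _ => integrable_finsetSum _ fun l _ => i1 k l
  have h1 : ∫ w, star (hy.fourier w) ⬝ᵥ (M.map (algebraMap ℝ ℂ) *ᵥ hy.fourier w)
      = ((∫ t in Set.Ici 0, y t ⬝ᵥ (M *ᵥ y t) : ℝ) : ℂ) := by
    simp only [e1, e2]
    rw [integral_finsetSum _ fun k _ => integrable_finsetSum _ fun l _ => i1 k l,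
      integral_finsetSum _ fun k _ => integrable_finsetSum _ fun l _ => i2 k l]
    push_cast
    refine Finset.sum_congr rfl fun k _ => ?_
    rw [integral_finsetSum _ fun l _ => i1 k l, integral_finsetSum _ fun l _ => i2 k l]
    push_cast
    refine Finset.sum_congr rfl fun l _ => ?_
    rw [integral_const_mul, integral_const_mul, integral_star_halfLineFourier_mul]
    push_cast
    rfl
  have h2 := Complex.reCLM.integral_comp_comm i3
  rw [h1] at h2
  simpa using h2.symm

lemma conjTranspose_map_algebraMap {a b : Type*} (X : Matrix a b ℝ) :
    (X.map (algebraMap ℝ ℂ))ᴴ = (X.map (algebraMap ℝ ℂ))ᵀ := by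
  ext i j
  simp

namespace StateSpace

variable {n m p : Type*} [Fintype n] [DecidableEq n]

lemma isUnit_det_sub_of_isHurwitz {A : Matrix n n ℝ} (hA : IsHurwitz A) {s : ℂ} (hs : 0 ≤ s.re) :
    IsUnit (s • (1 : Matrix n n ℂ) - A.map (algebraMap ℝ ℂ)).det := by
  by_contra h
  have : s ∈ spectrum ℂ (A.map (algebraMap ℝ ℂ)) := by
    rw [spectrum.mem_iff, Algebra.algebraMap_eq_smul_one, isUnit_iff_isUnit_det]
    exact h
  exact absurd (hA s this) (not_lt.2 hs)

/-- The coefficients are real and `-iω` is the conjugate of `iω`; this makes the multiplier a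
Hermitian-type form `Ψᴴ M Ψ` on the imaginary axis. -/
lemma transfer_neg_transpose (Ψ : StateSpace n m p) (w : ℝ) :
    (Ψ.transfer (-(Complex.I * w)))ᵀ = (Ψ.transfer (Complex.I * w))ᴴ := by
  have hs : star (Complex.I * w) = -(Complex.I * w) := by simp
  simp only [transfer, conjTranspose_add, conjTranspose_mul, transpose_add, transpose_mul,
    conjTranspose_nonsing_inv, transpose_nonsing_inv, conjTranspose_sub, transpose_sub,
    conjTranspose_smul, transpose_smul, conjTranspose_one, transpose_one,
    conjTranspose_map_algebraMap, hs]

variable [Fintype m] [Fintype p]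

lemma star_dotProduct_multiplier (Ψ : StateSpace n m p) (M : Matrix p p ℝ) (w : ℝ) (U : m → ℂ) :
    star U ⬝ᵥ (Ψ.multiplier M (Complex.I * w) *ᵥ U)
      = star (Ψ.transfer (Complex.I * w) *ᵥ U) ⬝ᵥ
        (M.map (algebraMap ℝ ℂ) *ᵥ (Ψ.transfer (Complex.I * w) *ᵥ U)) := by
  rw [multiplier, transfer_neg_transpose, ← mulVec_mulVec, ← mulVec_mulVec, star_mulVec,
    dotProduct_mulVec]

variable {u : ℝ → m → ℝ} {ξ : ℝ → n → ℝ}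

/-- Transforming the state equation gives `(sI - A) ξ̂ = B û` with `s = 2πiw`, solvable because a
Hurwitz `A` has no spectrum on the imaginary axis. -/
lemma fourier_output (Ψ : StateSpace n m p) (hΨ : IsHurwitz Ψ.A) (hu : SquareIntegrable u)
    (hξ : IsSolution Ψ.A Ψ.B u ξ) (h0 : ξ 0 = 0) (hy : SquareIntegrable (Ψ.output u ξ)) :
    ∀ᵐ w, hy.fourier w
      = Ψ.transfer (Complex.I * (2 * Real.pi * w : ℝ)) *ᵥ hu.fourier w := by
  have hξ2 : SquareIntegrable ξ := hξ.squareIntegrable hΨ hu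
  have hd : SquareIntegrable fun t => Ψ.A *ᵥ ξ t + Ψ.B *ᵥ u t := (hξ2.mulVec _).add (hu.mulVec _)
  have h1 : ∀ᵐ w, ∀ i, halfLineFourier (hd i) w
      = Complex.I * (2 * Real.pi * w : ℝ) * halfLineFourier (hξ2 i) w :=
    ae_all_iff.2 fun i => halfLineFourier_deriv (hξ i) (hξ2 i) (hd i) (congrFun h0 i)
  filter_upwards [h1, hξ2.fourier_mulVec_add hu Ψ.A Ψ.B hd, hξ2.fourier_mulVec_add hu Ψ.C Ψ.D hy]
    with w h1 h2 h3
  set s : ℂ := Complex.I * (2 * Real.pi * w : ℝ) with hs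
  have hunit := isUnit_det_sub_of_isHurwitz hΨ (s := s) (by simp [hs])
  have h4 : hd.fourier w = s • hξ2.fourier w := funext h1
  have h5 : (s • (1 : Matrix n n ℂ) - Ψ.A.map (algebraMap ℝ ℂ)) *ᵥ hξ2.fourier w
      = Ψ.B.map (algebraMap ℝ ℂ) *ᵥ hu.fourier w := by
    rw [sub_mulVec, smul_mulVec, one_mulVec, ← h4, h2, add_sub_cancel_left]
  have h6 : hξ2.fourier w = (s • (1 : Matrix n n ℂ) - Ψ.A.map (algebraMap ℝ ℂ))⁻¹ *ᵥ
      (Ψ.B.map (algebraMap ℝ ℂ) *ᵥ hu.fourier w) := by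
    rw [← h5, mulVec_mulVec, nonsing_inv_mul _ hunit, one_mulVec]
  rw [transfer, add_mulVec, ← mulVec_mulVec, ← mulVec_mulVec, ← h6]
  exact h3

lemma integral_output_eq (Ψ : StateSpace n m p) (hΨ : IsHurwitz Ψ.A) (M : Matrix p p ℝ)
    (hu : SquareIntegrable u) (hξ : IsSolution Ψ.A Ψ.B u ξ) (h0 : ξ 0 = 0) :
    ∫ t in Set.Ici 0, Ψ.output u ξ t ⬝ᵥ (M *ᵥ Ψ.output u ξ t)
      = ∫ w : ℝ, (star (hu.fourier w) ⬝ᵥ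
        (Ψ.multiplier M (Complex.I * (2 * Real.pi * w : ℝ)) *ᵥ hu.fourier w)).re := by
  have hy : SquareIntegrable (Ψ.output u ξ) :=
    ((hξ.squareIntegrable hΨ hu).mulVec _).add (hu.mulVec _)
  rw [hy.integral_dotProduct_mulVec M]
  refine integral_congr_ae ?_
  filter_upwards [Ψ.fourier_output hΨ hu hξ h0 hy] with w hw
  rw [hw, star_dotProduct_multiplier]

/-- The quadratic form of the matrix in the Kalman-Yakubovich-Popov lemma, polarized. -/
lemma dotProduct_kyp_mulVec (Ψ : StateSpace n m p) (Z : Matrix n n ℝ) (M : Matrix p p ℝ)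
    (x x' : n → ℝ) (v v' : m → ℝ) :
    Sum.elim x v ⬝ᵥ (Ψ.kyp Z M *ᵥ Sum.elim x' v')
      = (Ψ.A *ᵥ x + Ψ.B *ᵥ v) ⬝ᵥ (Z *ᵥ x') + x ⬝ᵥ (Z *ᵥ (Ψ.A *ᵥ x' + Ψ.B *ᵥ v'))
        + (Ψ.C *ᵥ x + Ψ.D *ᵥ v) ⬝ᵥ (M *ᵥ (Ψ.C *ᵥ x' + Ψ.D *ᵥ v')) := by
  have ho : ∀ (x : n → ℝ) (v : m → ℝ), Ψ.outerFactor *ᵥ Sum.elim x v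
      = Sum.elim x (Sum.elim (Ψ.A *ᵥ x + Ψ.B *ᵥ v) (Ψ.C *ᵥ x + Ψ.D *ᵥ v)) := fun x v => by
    simp [outerFactor, fromRows_mulVec, fromBlocks_mulVec]
  rw [kyp, ← mulVec_mulVec, ← mulVec_mulVec, dotProduct_mulVec, vecMul_transpose, ho, ho]
  simp [fromBlocks_mulVec, fromRows_mulVec, sumElim_dotProduct_sumElim]
  ring

end StateSpace

/-! ### The sign conditions on the multiplier -/

section Sign

variable {n p ζ κ : Type*}

lemma squareIntegrable_sumElim {a : ℝ → ζ → ℝ} {b : ℝ → κ → ℝ} (ha : SquareIntegrable a)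
    (hb : SquareIntegrable b) : SquareIntegrable fun t => Sum.elim (a t) (b t) := fun i => by
  rcases i with i | i
  · exact ha i
  · exact hb i

variable [Fintype n] [DecidableEq n] [Fintype p] [Fintype ζ] [Fintype κ]

lemma halfLineFourier_zero (h : MemLp (fun _ => (0 : ℝ)) 2 halfLine) :
    halfLineFourier h =ᵐ[volume] 0 :=
  halfLineFourier_ae_eq h (locallyIntegrable_const 0) fun φ => by simp

lemma star_sumElim_zero_dotProduct (X : Matrix (ζ ⊕ κ) (ζ ⊕ κ) ℂ) (v : κ → ℂ) :
    star (Sum.elim (0 : ζ → ℂ) v) ⬝ᵥ (X *ᵥ Sum.elim (0 : ζ → ℂ) v)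
      = star v ⬝ᵥ (X.toBlocks₂₂ *ᵥ v) := by
  have h : star (Sum.elim (0 : ζ → ℂ) v) = Sum.elim (0 : ζ → ℂ) (star v) := by
    ext i
    rcases i with i | i <;> simp
  rw [h]
  conv_lhs => rw [← fromBlocks_toBlocks X]
  simp [fromBlocks_mulVec, sumElim_dotProduct_sumElim]

/-- After Parseval, an input with vanishing first component meets only the lower right block of the
multiplier. -/
lemma NegSemidefLowerRight.integral_output_nonpos {Ψ : StateSpace n (ζ ⊕ κ) p}
    {M : Matrix p p ℝ} (hneg : NegSemidefLowerRight Ψ M) (hΨ : IsHurwitz Ψ.A) {w : ℝ → κ → ℝ}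
    (hw : SquareIntegrable w) {η : ℝ → n → ℝ}
    (hη : IsSolution Ψ.A Ψ.B (fun t => Sum.elim 0 (w t)) η) (h0 : η 0 = 0) :
    ∫ t in Set.Ici 0, Ψ.output (fun t => Sum.elim 0 (w t)) η t ⬝ᵥ
      (M *ᵥ Ψ.output (fun t => Sum.elim 0 (w t)) η t) ≤ 0 := by
  have hz : SquareIntegrable fun _ => (0 : ζ → ℝ) := fun _ => MemLp.zero'
  have hu := squareIntegrable_sumElim hz hw
  rw [Ψ.integral_output_eq hΨ M hu hη h0]
  refine integral_nonpos_of_ae ?_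
  have h1 : ∀ᵐ s, ∀ i : ζ, halfLineFourier (hu (Sum.inl i)) s = 0 :=
    ae_all_iff.2 fun i => halfLineFourier_zero (hu (Sum.inl i))
  filter_upwards [h1] with s hs
  have e : hu.fourier s = Sum.elim (0 : ζ → ℂ) (hw.fourier s) := by
    ext i
    rcases i with i | i
    · exact hs i
    · rfl
  rw [e, star_sumElim_zero_dotProduct]
  have h2 := (hneg.1 (2 * Real.pi * s)).re_dotProduct_nonneg (hw.fourier s)
  rw [neg_mulVec, dotProduct_neg] at h2
  simpa using h2

end Sign

/-! ### Steering the filter with an open loop input -/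

section Terminal

lemma StateSpace.output_add {n m p : Type*} [Fintype n] [Fintype m] (Ψ : StateSpace n m p)
    (u v : ℝ → m → ℝ) (ξ η : ℝ → n → ℝ) (t : ℝ) :
    Ψ.output (fun t => u t + v t) (fun t => ξ t + η t) t = Ψ.output u ξ t + Ψ.output v η t := by
  simp only [StateSpace.output, mulVec_add]
  abel

variable {n m p ζ κ : Type*} [Fintype n] [DecidableEq n] [Fintype p] [Fintype ζ] [Fintype κ]
  [Fintype m]

/-- Along two solutions, the supply rate balances the derivative of the bilinear storage function
up to the supply rate of the factor. -/
lemma StateSpace.isPrimitive_storage (Ψ : StateSpace n m p) {Z : Matrix n n ℝ}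
    {M : Matrix p p ℝ} {M' : Matrix m m ℝ} {C' : Matrix m n ℝ} {D' : Matrix m m ℝ}
    (hk : Ψ.kyp Z M = (fromCols C' D')ᵀ * M' * fromCols C' D')
    {u v : ℝ → m → ℝ} {ξ η : ℝ → n → ℝ} (hξ : IsSolution Ψ.A Ψ.B u ξ)
    (hη : IsSolution Ψ.A Ψ.B v η) :
    IsPrimitive (fun t => ξ t ⬝ᵥ (Z *ᵥ η t))
      (fun t => (C' *ᵥ ξ t + D' *ᵥ u t) ⬝ᵥ (M' *ᵥ (C' *ᵥ η t + D' *ᵥ v t))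
        - Ψ.output u ξ t ⬝ᵥ (M *ᵥ Ψ.output v η t)) := by
  refine (hξ.bilinear hη Z).congr_deriv fun t _ => ?_
  have h := Ψ.dotProduct_kyp_mulVec Z M (ξ t) (η t) (u t) (v t)
  rw [hk, ← mulVec_mulVec, ← mulVec_mulVec, dotProduct_mulVec, vecMul_transpose,
    fromCols_mulVec_sumElim, fromCols_mulVec_sumElim] at h
  rw [h]
  simp only [StateSpace.output]
  ring

/-- The `0` stands where the supply of the factor was, once its output vanishes along one of the two
solutions. -/
lemma IsPrimitive.integral_Ici_eq {q f : ℝ → ℝ} (h : IsPrimitive q fun t => 0 - f t)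
    (hq : Integrable q halfLine) (hf : Integrable f halfLine) :
    ∫ t in Set.Ici 0, f t = q 0 := by
  have hf' : IntegrableOn f (Set.Ioi 0) :=
    IntegrableOn.mono_set (t := Set.Ici 0) hf Set.Ioi_subset_Ici_self
  have hq' : IntegrableOn q (Set.Ioi 0) :=
    IntegrableOn.mono_set (t := Set.Ici 0) hq Set.Ioi_subset_Ici_self
  have h1 := h.integral_deriv_eq_neg hq' ((integrable_zero _ _ _).sub hf')
  simp only [zero_sub, integral_neg] at h1
  rw [integral_Ici_eq_integral_Ioi]
  linarith

/-- The pair `(us, ξs)` that zeroes the factor's output is a critical point of the supply with value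
`xᵀZx`. Deviations in the second input alone contribute only a nonpositive second-order term, so the
first component of `us` works against every `w`. -/
lemma exists_openLoop_input [DecidableEq ζ] [DecidableEq κ] {Ψ : StateSpace n (ζ ⊕ κ) p}
    {M : Matrix p p ℝ} {Z : Matrix n n ℝ} (hΨ : IsHurwitz Ψ.A) (hneg : NegSemidefLowerRight Ψ M)
    (hZ : Ψ.Certifies M Z) (x : n → ℝ) :
    ∃ z : ℝ → ζ → ℝ, SquareIntegrable z ∧ ∀ w : ℝ → κ → ℝ, SquareIntegrable w →
      ∃ ξ : ℝ → n → ℝ, IsSolution Ψ.A Ψ.B (fun t => Sum.elim (z t) (w t)) ξ ∧ ξ 0 = x ∧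
        ∫ t in Set.Ici 0, Ψ.output (fun t => Sum.elim (z t) (w t)) ξ t ⬝ᵥ
          (M *ᵥ Ψ.output (fun t => Sum.elim (z t) (w t)) ξ t) ≤ x ⬝ᵥ (Z *ᵥ x) := by
  obtain ⟨-, M', C', D', -, hD, hk, hcl⟩ := hZ
  set Acl := Ψ.A - Ψ.B * D'⁻¹ * C' with hAcl
  set ξs : ℝ → n → ℝ := fun t => NormedSpace.exp (t • Acl) *ᵥ x with hξs
  set us : ℝ → ζ ⊕ κ → ℝ := fun t => -((D'⁻¹ * C') *ᵥ ξs t) with hus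
  have hsol0 : IsSolution Acl (0 : Matrix n (ζ ⊕ κ) ℝ) 0 ξs := isSolution_exp_smul Acl x
  have hξs2 : SquareIntegrable ξs := hsol0.squareIntegrable hcl fun _ => MemLp.zero'
  have hus2 : SquareIntegrable us := fun i => (hξs2.mulVec (D'⁻¹ * C') i).neg
  have hsol : IsSolution Ψ.A Ψ.B us ξs := fun i => by
    refine (hsol0 i).congr_deriv fun t _ => ?_
    simp [hAcl, hus, sub_mulVec, mulVec_neg, mulVec_mulVec, Matrix.mul_assoc, ← sub_eq_add_neg]
  -- The factor's output vanishes, which removes its supply from the storage identity with any other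
  -- solution.
  have hcrit : ∀ t, C' *ᵥ ξs t + D' *ᵥ us t = 0 := fun t => by
    simp only [hus, mulVec_neg, mulVec_mulVec]
    rw [← Matrix.mul_assoc, mul_nonsing_inv _ hD, Matrix.one_mul, add_neg_cancel]
  have hys : SquareIntegrable (Ψ.output us ξs) := (hξs2.mulVec _).add (hus2.mulVec _)
  refine ⟨fun t i => us t (Sum.inl i), fun i => hus2 _, fun w hw => ?_⟩
  set h : ℝ → κ → ℝ := fun t => w t - fun i => us t (Sum.inr i) with hh
  have hh2 : SquareIntegrable h := hw.sub fun i => hus2 (Sum.inr i)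
  set v : ℝ → ζ ⊕ κ → ℝ := fun t => Sum.elim 0 (h t) with hv
  have hv2 : SquareIntegrable v := squareIntegrable_sumElim (fun _ => MemLp.zero') hh2
  have huv : (fun t => Sum.elim (fun i => us t (Sum.inl i)) (w t)) = fun t => us t + v t := by
    funext t i
    rcases i with i | i <;> simp [hv, hh]
  -- The deviation starts at zero, so the boundary values of the cross terms vanish and Parseval
  -- applies to `η`.
  obtain ⟨η, hη, hη0⟩ := IsSolution.exists_of_intervalIntegrable Ψ.A Ψ.B
    (fun T hT j => hv2.intervalIntegrable j hT) 0
  have hη2 : SquareIntegrable η := hη.squareIntegrable hΨ hv2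
  have hyη : SquareIntegrable (Ψ.output v η) := (hη2.mulVec _).add (hv2.mulVec _)
  have hx0 : ξs 0 = x := by simp [hξs, NormedSpace.exp_zero]
  have i1 := hys.integrable_dotProduct (hys.mulVec M)
  have i2 := hys.integrable_dotProduct (hyη.mulVec M)
  have i3 := hyη.integrable_dotProduct (hys.mulVec M)
  have i4 := hyη.integrable_dotProduct (hyη.mulVec M)
  have e1 : ∫ t in Set.Ici 0, Ψ.output us ξs t ⬝ᵥ (M *ᵥ Ψ.output us ξs t) = x ⬝ᵥ (Z *ᵥ x) := by
    rw [← hx0]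
    refine IsPrimitive.integral_Ici_eq (q := fun t => ξs t ⬝ᵥ (Z *ᵥ ξs t)) ?_
      (hξs2.integrable_dotProduct (hξs2.mulVec Z)) i1
    refine (Ψ.isPrimitive_storage hk hsol hsol).congr_deriv fun t _ => ?_
    rw [hcrit, zero_dotProduct]
  have e2 : ∫ t in Set.Ici 0, Ψ.output us ξs t ⬝ᵥ (M *ᵥ Ψ.output v η t) = 0 := by
    have := IsPrimitive.integral_Ici_eq (q := fun t => ξs t ⬝ᵥ (Z *ᵥ η t))
      ((Ψ.isPrimitive_storage hk hsol hη).congr_deriv fun t _ => by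
        rw [hcrit, zero_dotProduct]) (hξs2.integrable_dotProduct (hη2.mulVec Z)) i2
    rw [this, hη0, mulVec_zero, dotProduct_zero]
  -- Repeating the argument with the roles exchanged avoids any appeal to symmetry of `M` or `Z`.
  have e3 : ∫ t in Set.Ici 0, Ψ.output v η t ⬝ᵥ (M *ᵥ Ψ.output us ξs t) = 0 := by
    have := IsPrimitive.integral_Ici_eq (q := fun t => η t ⬝ᵥ (Z *ᵥ ξs t))
      ((Ψ.isPrimitive_storage hk hη hsol).congr_deriv fun t _ => by
        rw [hcrit, mulVec_zero, dotProduct_zero]) (hη2.integrable_dotProduct (hξs2.mulVec Z)) i3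
    rw [this, hη0, zero_dotProduct]
  have e4 := hneg.integral_output_nonpos hΨ hh2 hη hη0
  refine ⟨fun t => ξs t + η t, ?_, by simp [hx0, hη0], ?_⟩
  · rw [huv]
    exact hsol.add hη
  · rw [huv]
    simp only [StateSpace.output_add, mulVec_add, dotProduct_add, add_dotProduct]
    have s1 := integral_add (i1.add i3) (i2.add i4)
    have s2 := integral_add i1 i3
    have s3 := integral_add i2 i4
    simp only [Pi.add_apply] at s1 s2 s3
    rw [s1, s2, s3, e1, e2, e3]
    linarith

end Terminal

/-! ### Concatenation of signals and trajectories -/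

lemma measurePreserving_sub_Ici (T : ℝ) :
    MeasurePreserving (fun t => t - T) (volume.restrict (Set.Ici T)) halfLine := by
  have h := (measurePreserving_sub_right (volume : Measure ℝ) T).restrict_preimage
    (measurableSet_Ici (a := (0 : ℝ)))
  have e : (fun t : ℝ => t - T) ⁻¹' Set.Ici 0 = Set.Ici T := by
    ext t
    simp
  rwa [e] at h

lemma measurePreserving_add_Ici (T : ℝ) :
    MeasurePreserving (fun t => t + T) halfLine (volume.restrict (Set.Ici T)) := by
  have h := (measurePreserving_add_right (volume : Measure ℝ) T).restrict_preimage
    (measurableSet_Ici (a := T))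
  have e : (fun t : ℝ => t + T) ⁻¹' Set.Ici T = Set.Ici 0 := by
    ext t
    simp
  rwa [e] at h

/-- The signal that follows `f` up to time `T` and the delayed signal `g` afterwards. -/
noncomputable def concat {E : Type*} (T : ℝ) (f g : ℝ → E) (t : ℝ) : E := if t ≤ T then f t else g (t - T)

lemma concat_of_le {E : Type*} {T : ℝ} (f g : ℝ → E) {t : ℝ} (h : t ≤ T) :
    concat T f g t = f t := if_pos h

lemma concat_of_lt {E : Type*} {T : ℝ} (f g : ℝ → E) {t : ℝ} (h : T < t) :
    concat T f g t = g (t - T) := if_neg (not_le.2 h)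

lemma memLp_concat {E : Type*} [NormedAddCommGroup E] {T : ℝ} {f g : ℝ → E}
    (hf : MemLp f 2 (volume.restrict (Set.Icc 0 T))) (hg : MemLp g 2 halfLine) :
    MemLp (concat T f g) 2 halfLine := by
  have e : concat T f g
      = (Set.Iic T).indicator f + (Set.Ioi T).indicator fun t => g (t - T) := by
    funext t
    rcases le_or_gt t T with h | h
    · simp [concat, h]
    · simp [concat, h, not_le.2 h]
  rw [e]
  refine MemLp.add ?_ ?_
  · rw [memLp_indicator_iff_restrict measurableSet_Iic, Measure.restrict_restrict measurableSet_Iic,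
      Set.inter_comm, Set.Ici_inter_Iic]
    exact hf
  · rw [memLp_indicator_iff_restrict measurableSet_Ioi, Measure.restrict_restrict measurableSet_Ioi]
    have h := hg.comp_measurePreserving (measurePreserving_sub_Ici T)
    have hsub : Set.Ioi T ∩ Set.Ici 0 ⊆ Set.Ici T := fun t ht => (Set.mem_Ioi.1 ht.1).le
    exact h.mono_measure (Measure.restrict_mono hsub le_rfl)

lemma integral_Ioi_concat (T : ℝ) (f g : ℝ → ℝ) :
    ∫ t in Set.Ioi T, concat T f g t = ∫ t in Set.Ici 0, g t := by
  have h1 : ∫ t in Set.Ioi T, concat T f g t = ∫ t in Set.Ici T, g (t - T) := by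
    rw [integral_Ici_eq_integral_Ioi]
    exact setIntegral_congr_fun measurableSet_Ioi fun t ht => concat_of_lt f g ht
  rw [h1]
  exact (measurePreserving_sub_Ici T).integral_comp
    (MeasurableEquiv.subRight T).measurableEmbedding g

lemma integral_Ici_concat {T : ℝ} (hT : 0 ≤ T) (f g : ℝ → ℝ)
    (h : Integrable (concat T f g) halfLine) :
    ∫ t in Set.Ici 0, concat T f g t = (∫ t in (0 : ℝ)..T, f t) + ∫ t in Set.Ici 0, g t := by
  have h' : IntegrableOn (concat T f g) (Set.Icc 0 T ∪ Set.Ioi T) := by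
    rw [Set.Icc_union_Ioi_eq_Ici hT]
    exact h
  have hd : Disjoint (Set.Icc 0 T) (Set.Ioi T) :=
    Set.disjoint_left.2 fun t h1 h2 => not_lt.2 h1.2 h2
  have hs := setIntegral_union hd measurableSet_Ioi (h'.mono_set Set.subset_union_left)
    (h'.mono_set Set.subset_union_right)
  rw [Set.Icc_union_Ioi_eq_Ici hT, integral_Ioi_concat, setIntegral_congr_fun measurableSet_Icc
    (fun t ht => concat_of_le f g ht.2)] at hs
  rw [hs, intervalIntegral.integral_of_le hT, integral_Icc_eq_integral_Ioc]

/-- The matching condition `g 0 = f T` excludes a jump at the junction. -/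
lemma IsPrimitive.concat {f f' g g' : ℝ → ℝ} {T : ℝ} (hT : 0 ≤ T) (hf : IsPrimitive f f')
    (hg : IsPrimitive g g') (h : g 0 = f T) :
    IsPrimitive (concat T f g) (concat T f' g') := by
  have c1 : ∀ S, 0 ≤ S → S ≤ T → Set.EqOn (IQC.concat T f' g') f' (Set.uIoc 0 S) :=
    fun S h0 hS t ht => by
      rw [Set.uIoc_of_le h0] at ht
      exact concat_of_le f' g' (ht.2.trans hS)
  have c2 : ∀ S, T ≤ S → Set.EqOn (IQC.concat T f' g') (fun t => g' (t - T)) (Set.uIoc T S) :=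
    fun S hS t ht => by
      rw [Set.uIoc_of_le hS] at ht
      exact concat_of_lt f' g' ht.1
  have i1 : ∀ S, 0 ≤ S → S ≤ T → IntervalIntegrable (IQC.concat T f' g') volume 0 S :=
    fun S h0 hS => (hf.intervalIntegrable S h0).congr (c1 S h0 hS).symm
  have i2 : ∀ S, T ≤ S → IntervalIntegrable (IQC.concat T f' g') volume T S := fun S hS => by
    refine IntervalIntegrable.congr (c2 S hS).symm ?_
    have := (hg.intervalIntegrable (S - T) (by linarith)).comp_sub_right T
    simpa using this
  have e1 : ∀ S, 0 ≤ S → S ≤ T →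
      ∫ t in (0 : ℝ)..S, IQC.concat T f' g' t = ∫ t in (0 : ℝ)..S, f' t := fun S h0 hS =>
    intervalIntegral.integral_congr_ae (Filter.Eventually.of_forall (c1 S h0 hS))
  have e2 : ∀ S, T ≤ S → ∫ t in T..S, IQC.concat T f' g' t = ∫ t in T..S, g' (t - T) :=
    fun S hS => intervalIntegral.integral_congr_ae (Filter.Eventually.of_forall (c2 S hS))
  refine ⟨fun S hS => ?_, fun S hS => ?_⟩
  · rcases le_total S T with h1 | h1
    · exact i1 S hS h1
    · exact (i1 T hT le_rfl).trans (i2 S h1)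
  · rw [concat_of_le f g hT]
    rcases le_or_gt S T with h1 | h1
    · rw [concat_of_le f g h1, hf.eq_integral S hS, e1 S hS h1]
    · rw [concat_of_lt f g h1, hg.eq_integral (S - T) (by linarith), h, hf.eq_integral T hT,
        ← intervalIntegral.integral_add_adjacent_intervals (i1 T hT le_rfl) (i2 S h1.le),
        e1 T hT le_rfl, e2 S h1.le,
        intervalIntegral.integral_comp_sub_right (fun t => g' t) T]
      simp [add_assoc]

lemma IsPrimitive.congr_ae {f f' g' : ℝ → ℝ} (hf : IsPrimitive f f') (h : f' =ᵐ[halfLine] g') :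
    IsPrimitive f g' := by
  have h' : ∀ T : ℝ, 0 ≤ T → f' =ᵐ[volume.restrict (Set.uIoc 0 T)] g' := fun T hT =>
    ae_mono (Measure.restrict_mono (fun t ht => by
      rw [Set.uIoc_of_le hT] at ht
      exact ht.1.le) le_rfl) h
  refine ⟨fun T hT => (hf.intervalIntegrable T hT).congr_ae (h' T hT), fun T hT => ?_⟩
  rw [hf.eq_integral T hT, intervalIntegral.integral_congr_ae_restrict (h' T hT)]

/-- The input `r` is matched only almost everywhere since elements of `L2e` are classes. -/
lemma IsSolution.concat {n m : Type*} [Fintype n] [Fintype m] {A : Matrix n n ℝ}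
    {B : Matrix n m ℝ} {u v r : ℝ → m → ℝ} {ξ η : ℝ → n → ℝ} {T : ℝ} (hT : 0 ≤ T)
    (hξ : IsSolution A B u ξ) (hη : IsSolution A B v η) (h : η 0 = ξ T)
    (hr : ∀ᵐ t ∂halfLine, r t = IQC.concat T u v t) :
    IsSolution A B r (IQC.concat T ξ η) := fun i => by
  have e : ∀ {κ : Type _} (a b : ℝ → κ → ℝ) (i : κ) (t : ℝ), IQC.concat T a b t i
      = IQC.concat T (fun t => a t i) (fun t => b t i) t := fun a b i t => by
    rcases le_or_gt t T with ht | ht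
    · simp only [concat_of_le _ _ ht]
    · simp only [concat_of_lt _ _ ht]
  have h1 := (hξ i).concat hT (hη i) (congrFun h i)
  have e1 : (fun t => IQC.concat T ξ η t i)
      = IQC.concat T (fun t => ξ t i) (fun t => η t i) := funext (e ξ η i)
  rw [e1]
  refine h1.congr_ae ?_
  filter_upwards [hr] with t ht
  rw [ht]
  rcases le_or_gt t T with ht | ht
  · simp only [concat_of_le _ _ ht]
  · simp only [concat_of_lt _ _ ht]

/-! ### Signals in `L₂ₑ` -/

section Signals

variable {ζ κ : Type*} [Fintype ζ] [Fintype κ]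

lemma IsL2.squareIntegrable {x : L2e ζ} (hx : IsL2 x) : SquareIntegrable fun t i => x t i :=
  fun i => MemLp.eval_piLp hx i

lemma L2e.intervalIntegrable (x : L2e ζ) {T : ℝ} (hT : 0 ≤ T) (i : ζ) :
    IntervalIntegrable (fun t => x t i) volume 0 T := by
  rw [intervalIntegrable_iff_integrableOn_Icc_of_le hT]
  exact ((x.2 T).eval_piLp i).integrable (by norm_num)

lemma truncate_coe_ae (T : ℝ) (x : L2e ζ) :
    truncate T x =ᵐ[halfLine] (Set.Iic T).indicator x :=
  AEEqFun.coeFn_mk _ (aestronglyMeasurable_indicator T x)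

lemma truncate_eq_truncate_iff {T : ℝ} {x y : L2e ζ} :
    truncate T x = truncate T y ↔ ∀ᵐ t ∂halfLine, t ≤ T → x t = y t := by
  have h1 : truncate T x = truncate T y ↔ truncate T x =ᵐ[halfLine] truncate T y :=
    Subtype.ext_iff.trans AEEqFun.ext_iff
  rw [h1]
  constructor
  · intro h
    filter_upwards [h, truncate_coe_ae T x, truncate_coe_ae T y] with t h2 h3 h4 ht
    rw [h3, h4] at h2
    simpa [ht] using h2
  · intro h
    filter_upwards [h, truncate_coe_ae T x, truncate_coe_ae T y] with t h2 h3 h4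
    rw [h3, h4]
    by_cases ht : t ≤ T
    · simp [ht, h2 ht]
    · simp [ht]

lemma IsCausal.ae_eq {Δ : L2e ζ → L2e κ} (hΔ : IsCausal Δ) {T : ℝ} (hT : 0 < T) {x y : L2e ζ}
    (h : ∀ᵐ t ∂halfLine, t ≤ T → x t = y t) :
    ∀ᵐ t ∂halfLine, t ≤ T → Δ x t = Δ y t := by
  rw [← truncate_eq_truncate_iff] at h ⊢
  rw [hΔ T hT x, hΔ T hT y, h]

/-- A square integrable function as an element of `L₂ₑ`. -/
noncomputable def L2e.ofMemLp (f : ℝ → EuclideanSpace ℝ ζ) (hf : MemLp f 2 halfLine) : L2e ζ :=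
  ⟨AEEqFun.mk f hf.1, fun _ => ((memLp_congr_ae (AEEqFun.coeFn_mk f hf.1)).2 hf).mono_measure
    (Measure.restrict_mono Set.Icc_subset_Ici_self le_rfl)⟩

lemma L2e.ofMemLp_coe_ae (f : ℝ → EuclideanSpace ℝ ζ) (hf : MemLp f 2 halfLine) :
    L2e.ofMemLp f hf =ᵐ[halfLine] f := AEEqFun.coeFn_mk f hf.1

lemma L2e.isL2_ofMemLp (f : ℝ → EuclideanSpace ℝ ζ) (hf : MemLp f 2 halfLine) :
    IsL2 (L2e.ofMemLp f hf) := (memLp_congr_ae (L2e.ofMemLp_coe_ae f hf)).2 hf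

lemma squareIntegrable_col {z : L2e ζ} {w : L2e κ} (hz : IsL2 z) (hw : IsL2 w) :
    SquareIntegrable (col z w) := squareIntegrable_sumElim hz.squareIntegrable hw.squareIntegrable

/-- Parseval turns the frequency-domain constraint into a time-domain one, after reconciling the two
frequency scales `ω` and `ω / 2π`. -/
lemma SatisfiesIQC.integral_output_nonneg {n p : Type*} [Fintype n] [DecidableEq n] [Fintype p]
    {Ψ : StateSpace n (ζ ⊕ κ) p} {M : Matrix p p ℝ} {Δ : L2e ζ → L2e κ} {hΔ : IsBounded Δ}
    (hiqc : SatisfiesIQC Ψ M Δ hΔ) (hΨ : IsHurwitz Ψ.A) {z : L2e ζ} (hz : IsL2 z)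
    {ξ : ℝ → n → ℝ} (hξ : IsSolution Ψ.A Ψ.B (col z (Δ z)) ξ) (h0 : ξ 0 = 0) :
    0 ≤ ∫ t in Set.Ici 0,
      Ψ.output (col z (Δ z)) ξ t ⬝ᵥ (M *ᵥ Ψ.output (col z (Δ z)) ξ t) := by
  have hw := hΔ.isL2 hz
  have hu := squareIntegrable_col hz hw
  rw [Ψ.integral_output_eq hΨ M hu hξ h0]
  set Z := (𝓕 ((memLp_extendZero hz).toLp (extendZero z)) :
    Lp (EuclideanSpace ℂ ζ) 2 (volume : Measure ℝ)) with hZ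
  set W := (𝓕 ((memLp_extendZero hw).toLp (extendZero (Δ z))) :
    Lp (EuclideanSpace ℂ κ) 2 (volume : Measure ℝ)) with hW
  let F : ℝ → ℝ := fun s => (star (Sum.elim (Z s) (W s) : ζ ⊕ κ → ℂ) ⬝ᵥ
    (Ψ.multiplier M (Complex.I * (2 * Real.pi * s : ℝ)) *ᵥ Sum.elim (Z s) (W s))).re
  have h1 : 0 ≤ ∫ w, F (w / (2 * Real.pi)) := by
    refine (hiqc z hz).trans_eq (integral_congr_ae (Filter.Eventually.of_forall fun w => ?_))
    have e : 2 * Real.pi * (w / (2 * Real.pi)) = w := by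
      field_simp
    simp only [F, e]
    rfl
  -- The change of variables only contributes the positive factor `2π`.
  rw [Measure.integral_comp_div, abs_of_pos Real.two_pi_pos, smul_eq_mul] at h1
  have h2 : 0 ≤ ∫ s, F s := nonneg_of_mul_nonneg_right h1 Real.two_pi_pos
  refine h2.trans_eq (integral_congr_ae ?_)
  have hz' : ∀ᵐ s, ∀ i, Z s i = halfLineFourier (hu (Sum.inl i)) s :=
    ae_all_iff.2 fun i => fourier_toLp_extendZero_apply hz i (hu (Sum.inl i))
  have hw' : ∀ᵐ s, ∀ i, W s i = halfLineFourier (hu (Sum.inr i)) s :=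
    ae_all_iff.2 fun i => fourier_toLp_extendZero_apply hw i (hu (Sum.inr i))
  filter_upwards [hz', hw'] with s h3 h4
  have e : (Sum.elim (Z s) (W s) : ζ ⊕ κ → ℂ) = hu.fourier s := by
    funext i
    rcases i with i | i
    · exact h3 i
    · exact h4 i
  simp only [F, e]

/-- The frequency domain inequality for the bounded causal system `Δ` and a certificate `Z` of a
canonical factorization imply the finite horizon inequality with terminal cost `Z`. -/
theorem SatisfiesIQC.finiteHorizonIQC {n p : Type*} [Fintype n] [DecidableEq n] [Fintype p]
    [DecidableEq ζ] [DecidableEq κ] {Ψ : StateSpace n (ζ ⊕ κ) p} {M : Matrix p p ℝ}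
    {Δ : L2e ζ → L2e κ} {hbounded : IsBounded Δ} (hiqc : SatisfiesIQC Ψ M Δ hbounded)
    (hΨ : IsHurwitz Ψ.A) (hcausal : IsCausal Δ) (hneg : NegSemidefLowerRight Ψ M)
    {Z : Matrix n n ℝ} (hZ : Ψ.Certifies M Z) : FiniteHorizonIQC Ψ M Z Δ := by
  refine ⟨hZ.1, fun z ξ htraj T hT => ?_⟩
  have hξ : IsSolution Ψ.A Ψ.B (col z (Δ z)) ξ := htraj.isSolution fun S hS j => by
    rcases j with j | j
    · exact z.intervalIntegrable hS j
    · exact (Δ z).intervalIntegrable hS j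
  have hξ0 : ξ 0 = 0 := by simpa using htraj.2 0 le_rfl
  -- `zc` depends on `ξ T` only; the bound `hcont` holds for every later response, whatever `Δ`
  -- produces.
  obtain ⟨zc, hzc, hcont⟩ := exists_openLoop_input hΨ hneg hZ (ξ T)
  have hzc' : MemLp (fun t => WithLp.toLp 2 (zc t) : ℝ → EuclideanSpace ℝ ζ) 2 halfLine :=
    MemLp.of_eval_piLp hzc
  have hmem := memLp_concat (z.2 T) hzc'
  set z' := L2e.ofMemLp _ hmem
  have hz' : IsL2 z' := L2e.isL2_ofMemLp _ hmem
  have hz'ae : ∀ᵐ t ∂halfLine, z' t = concat T z (fun t => WithLp.toLp 2 (zc t)) t :=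
    L2e.ofMemLp_coe_ae _ hmem
  have hw' : IsL2 (Δ z') := hbounded.isL2 hz'
  have hpast : ∀ᵐ t ∂halfLine, t ≤ T → Δ z' t = Δ z t := by
    refine hcausal.ae_eq hT ?_
    filter_upwards [hz'ae] with t ht htT
    rw [ht, concat_of_le _ _ htT]
  -- The tail of `Δ z'`, moved back to time zero, serves as the disturbance `w`; boundedness of `Δ`
  -- makes it admissible.
  have hwc : SquareIntegrable fun t i => Δ z' (t + T) i := fun i =>
    ((hw'.squareIntegrable i).mono_measure (Measure.restrict_mono
      (Set.Ici_subset_Ici.2 hT.le) le_rfl)).comp_measurePreserving (measurePreserving_add_Ici T)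
  obtain ⟨ξc, hξc, hξc0, hle⟩ := hcont _ hwc
  have hinput : ∀ᵐ t ∂halfLine, col z' (Δ z') t = concat T (col z (Δ z))
      (fun t => Sum.elim (zc t) fun i => Δ z' (t + T) i) t := by
    filter_upwards [hz'ae, hpast] with t h1 h2
    simp only [col, h1]
    rcases le_or_gt t T with ht | ht
    · rw [concat_of_le _ _ ht, concat_of_le _ _ ht, h2 ht]
      rfl
    · simp only [concat_of_lt _ _ ht, sub_add_cancel]
  have hξ' := hξ.concat hT.le hξc hξc0 hinput
  have h0' : concat T ξ ξc 0 = 0 := by rw [concat_of_le _ _ hT.le, hξ0]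
  have hnn := hiqc.integral_output_nonneg hΨ hz' hξ' h0'
  have hu' := squareIntegrable_col hz' hw'
  have hy' : SquareIntegrable (Ψ.output (col z' (Δ z')) (concat T ξ ξc)) :=
    ((hξ'.squareIntegrable hΨ hu').mulVec _).add (hu'.mulVec _)
  have hint := hy'.integrable_dotProduct (hy'.mulVec M)
  have hsupply : ∀ᵐ t ∂halfLine,
      Ψ.output (col z' (Δ z')) (concat T ξ ξc) t ⬝ᵥ
        (M *ᵥ Ψ.output (col z' (Δ z')) (concat T ξ ξc) t)
      = concat T (fun t => Ψ.output (col z (Δ z)) ξ t ⬝ᵥ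
          (M *ᵥ Ψ.output (col z (Δ z)) ξ t))
        (fun t => Ψ.output (fun t => Sum.elim (zc t) fun i => Δ z' (t + T) i) ξc t ⬝ᵥ
          (M *ᵥ Ψ.output (fun t => Sum.elim (zc t) fun i => Δ z' (t + T) i) ξc t)) t := by
    filter_upwards [hinput] with t ht
    simp only [StateSpace.output, ht]
    rcases le_or_gt t T with h | h
    · simp only [concat_of_le _ _ h]
    · simp only [concat_of_lt _ _ h]
  -- The total supply splits at `T`: the first piece is the integral in the claim, and `hle` bounds
  -- the second.
  rw [integral_congr_ae hsupply, integral_Ici_concat hT.le _ _ (hint.congr hsupply)] at hnn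
  exact hnn.trans (add_le_add le_rfl hle)

end Signals

end IQC

theorem mainTheorem5 {nz nw ny nξ : ℕ}
    (Ψ : IQC.StateSpace (Fin nξ) (Fin nz ⊕ Fin nw) (Fin ny)) (hΨ : IQC.IsHurwitz Ψ.A)
    (M : Matrix (Fin ny) (Fin ny) ℝ) (hM : M.IsSymm)
    (Δ : IQC.L2e (Fin nz) → IQC.L2e (Fin nw))
    (hcausal : IQC.IsCausal Δ) (hbounded : IQC.IsBounded Δ)
    (hiqc : IQC.SatisfiesIQC Ψ M Δ hbounded)
    (hneg : IQC.NegSemidefLowerRight Ψ M)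
    (Z : Matrix (Fin nξ) (Fin nξ) ℝ) (hZ : Ψ.Certifies M Z) :
    IQC.FiniteHorizonIQC Ψ M Z Δ :=
  hiqc.finiteHorizonIQC hΨ hcausal hneg hZ
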